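/- **Model.** There are processes $1,\dots,n$, shared variables $x$ with a memory content $\mathsf m(x)$, and for every process $i$ a FIFO store buffer, emptied by a dispatcher $d_i$. The processes and the dispatchers are the *agents*; a *node* $\langle b,t\rangle$ is an agent $b$ with a time $t\in\mathbb N$. The local state of a process is the list of its observations so far (its actions, the values its reads returned, and invocations), initially empty. An implementation gives an initial memory and, for each process and local state, a nonempty set of allowed actions. In every round $t+1$ of a run (infinite, starting with empty buffers), each process performs the null action or an allowed, enabled action, namely: a read of $x$ (which returns the newest entry for $x$ in its own buffer (*read from buffer*, RfB) if there is one, otherwise $\mathsf m(x)$ (*read from memory*, RfM)); a write (which appends an entry to its buffer); a fence F (enabled iff its buffer is empty); $\mathrm{RMW}(x,v,v')$ (enabled iff its buffer is empty and $\mathsf m(x)=v$; sets $\mathsf m(x):=v'$); an internal action; or a response $\mathtt{return}$. Each $d_i$ may perform $\mathtt{prop}$, enabled iff $i$'s buffer is nonempty, which moves the oldest entry $(x,v)$ to memory; and the environment may invoke an operation at each process. Enabledness and the values read refer to the state at time $t$; these are the actions *at* the nodes $\langle b,t\rangle$. An RfM of $x$, an RMW on $x$ and a $\mathtt{prop}$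 of an entry for $x$ are the *memory accesses* of $x$. No two actions of a round may conflict, i.e. be memory accesses of the same variable, unless both are RfM, or one is by $d_i$ and the other is an RfM by $i$. **Occurs-before.** $\overset{ob}{\rightsquigarrow}_r$ is the least transitive relation on nodes such that for all $t<t'$: (1) $\langle b,t\rangle\overset{ob}{\rightsquigarrow}_r\langle b,t'\rangle$; (2) $\langle i,t\rangle\overset{ob}{\rightsquigarrow}_r\langle d_i,t'\rangle$ if the entry written, or read from the buffer, at $\langle i,t\rangle$ is propagated at $\langle d_i,t'\rangle$; (3) $\langle b,t\rangle\overset{ob}{\rightsquigarrow}_r\langle c,t'\rangle$ if both actions are memory accesses of the same variable, except if both are RfM, or if $b=d_i$, $c=i$ and the action at $\langle i,t'\rangle$ is an RfM; (4) $\langle d_i,t\rangle\overset{ob}{\rightsquigarrow}_r\langle i,t'\rangle$ if $d_i$ propagates at time $t$ and $i$ performs F or an RMW at time $t'$. **Operations.** An operation $\mathrm X$ invoked at process $i$ in round $t+1$ has $\mathrm X.s=\langle i,t\rangle$ and $t_{\mathrm X.s}=t$; if its matching response (the first response of $i$ in a later round) is performed in round $t'$, it *completes*, with $\mathrm X.e=\langle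 i,t'\rangle$ and $t_{\mathrm X.e}=t'$. Write $\mathrm X<_r\mathrm Y$ if $\mathrm X$ completes and $t_{\mathrm X.e}<t_{\mathrm Y.s}$; two operations not ordered by $<_r$ are concurrent. $\mathrm Y$ *runs in isolation* in $r$ if no other operation of $r$ is concurrent to it. $\mathrm X\overset{ob}{\rightsquigarrow}_r\mathrm Y$ means $\mathrm X.s\overset{ob}{\rightsquigarrow}_r\mathrm Y.e$. For a multi-writer multi-reader register with default value $v_0$, an *$\mathsf a$-operation* $\mathrm X\mathsf a$ is a write of $\mathsf a$ or a read that returns $\mathsf a$. Throughout, a process is invoked again only after a response in an earlier round to its previous invocation, each value is written at most once in a run, and $v_0$ is not written. An implementation is a *linearizable register implementation* if in each of its runs all completed operations and some of the pending ones can be arranged in a sequence that extends $<_r$, in which each completed read returns the value of the most recent preceding write ($v_0$ if there is none) and each completed write returns an acknowledgement. It is *obstruction-free* if, whenever an operation of a process $i$ is pending at time $T$ in a run, some run that agrees with it up to time $T$ completes that operation although from time $T$ on nothing is invoked and no process other than $i$ takes a step (dispatchers may propagate). **Theorem.** Let $r$ be a run of an obstruction-free linearizable register implementation in TSO, such that in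 no round of $r$ a process reads from its store buffer the very entry that its dispatcher propagates in that same round. Let $\mathrm X\mathsf a<_r\mathrm Y\mathsf b$ with $\mathsf a\ne\mathsf b$, and suppose that $\mathrm Y\mathsf b$ completes and runs in isolation in $r$. Then $\mathrm X\mathsf a\overset{ob}{\rightsquigarrow}_r\mathrm Y\mathsf b$. -/

import Mathlib

namespace TSO

/-! ### Agents, actions, local records -/

/-- The agents: the processes `i` and their local dispatchers `d_i`. -/
inductive Agent (n : ℕ) where
  | proc (i : Fin n)
  | disp (i : Fin n)

/-- A node `⟨b, t⟩`: the point at time `t` on the timeline of agent `b`. -/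
abbrev Node (n : ℕ) := Agent n × ℕ

/-- The two operations of a register with values in `V`, as invoked by the environment. -/
inductive RegOp (V : Type*) where
  | read
  | write (v : V)

/-- The responses of a register: the value returned by a read, the acknowledgement of a write. -/
inductive RegResp (V : Type*) where
  | val (v : V)
  | ack

/-- Actions of a process: the TSO actions, internal actions, and the response that ends the
pending operation.  `null` is the null action. -/
inductive Act (Var Val Lbl V : Type*) where
  | null
  | read (x : Var)
  | write (x : Var) (v : Val)
  | rmw (x : Var) (expected new : Val)
  | fence
  | internal (c : Lbl)
  | ret (w : RegResp V)

/-- What is recorded in the local state of a process.  A read is recorded with the value that it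
returned, but without its source (store buffer or memory). -/
inductive Rec (Var Val Lbl V : Type*) where
  | read (x : Var) (v : Val)
  | write (x : Var) (v : Val)
  | rmw (x : Var) (expected new : Val)
  | fence
  | internal (c : Lbl)
  | ret (w : RegResp V)
  | invoke (o : RegOp V)

/-- A local state: the list of everything observed so far, oldest first. -/
abbrev Local (Var Val Lbl V : Type*) := List (Rec Var Val Lbl V)

/-- The number of write events recorded in a local state. -/
def writeCount {Var Val Lbl V : Type*} : Local Var Val Lbl V → ℕ
  | [] => 0
  | Rec.write _ _ :: l => writeCount l + 1
  | _ :: l => writeCount l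

/-- An entry `⟨var, val⟩` of a store buffer.  The auxiliary field `idx` is `k` when the entry was
created by the `k`-th write of the owner of the buffer, so `⟨owner, idx⟩` is the tag of the entry.
No action and no local state depends on `idx`. -/
structure Item (Var Val : Type*) where
  var : Var
  val : Val
  idx : ℕ

/-- The newest entry for `x` in the store buffer `β` (oldest entry first), if there is one. -/
def lastItem {Var Val : Type*} [DecidableEq Var] (β : List (Item Var Val)) (x : Var) :
    Option (Item Var Val) :=
  (β.filter (fun it => decide (it.var = x))).getLast?

/-- A global state: main memory, store buffers (oldest entry first), local states. -/
structure GState (n : ℕ) (Var Val Lbl V : Type*) where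
  mem : Var → Val
  buf : Fin n → List (Item Var Val)
  loc : Fin n → Local Var Val Lbl V

/-- The value that a read of `x` by process `i` returns in state `σ`. -/
def GState.readVal {n : ℕ} {Var Val Lbl V : Type*} [DecidableEq Var]
    (σ : GState n Var Val Lbl V) (i : Fin n) (x : Var) : Val :=
  match lastItem (σ.buf i) x with
  | some it => it.val
  | none => σ.mem x

/-- The precondition of an action of process `i` in state `σ`. -/
def GState.Enabled {n : ℕ} {Var Val Lbl V : Type*}
    (σ : GState n Var Val Lbl V) (i : Fin n) : Act Var Val Lbl V → Prop
  | Act.fence => σ.buf i = []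
  | Act.rmw x e _ => σ.buf i = [] ∧ σ.mem x = e
  | _ => True

/-- What an action of process `i`, taken in state `σ`, adds to the local state of `i`. -/
def GState.record {n : ℕ} {Var Val Lbl V : Type*} [DecidableEq Var]
    (σ : GState n Var Val Lbl V) (i : Fin n) : Act Var Val Lbl V → Local Var Val Lbl V
  | Act.null => []
  | Act.read x => [Rec.read x (σ.readVal i x)]
  | Act.write x v => [Rec.write x v]
  | Act.rmw x e w => [Rec.rmw x e w]
  | Act.fence => [Rec.fence]
  | Act.internal c => [Rec.internal c]
  | Act.ret w => [Rec.ret w]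

/-- What an action of process `i`, taken in state `σ`, adds to the tail of its store buffer. -/
def GState.newItems {n : ℕ} {Var Val Lbl V : Type*}
    (σ : GState n Var Val Lbl V) (i : Fin n) : Act Var Val Lbl V → List (Item Var Val)
  | Act.write x v => [⟨x, v, writeCount (σ.loc i) + 1⟩]
  | _ => []

/-! ### Runs -/

/-- A sequence of global states together with the joint actions: in round `t + 1`, at
`state t`, process `i` performs `act t i`, the dispatcher `d_i` propagates iff `prop t i`, and the
environment invokes `o` at process `i` iff `inv t i = some o`.  The conditions that make it a run
are in `Run.IsRunOf`. -/
structure Run (n : ℕ) (Var Val Lbl V : Type*) where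
  state : ℕ → GState n Var Val Lbl V
  act : ℕ → Fin n → Act Var Val Lbl V
  prop : ℕ → Fin n → Prop
  inv : ℕ → Fin n → Option (RegOp V)

/-- A register implementation: a (nondeterministic) protocol for every process, and the initial
content of the memory. -/
structure RegImpl (n : ℕ) (Var Val Lbl V : Type*) where
  protocol : Fin n → Local Var Val Lbl V → Set (Act Var Val Lbl V)
  nonempty : ∀ i l, (protocol i l).Nonempty
  init : Var → Val

namespace Run

variable {n : ℕ} {Var Val Lbl V : Type*} [DecidableEq Var]

/-- `⟨d_i, t⟩` propagates the buffer entry `it`. -/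
def IsProp (r : Run n Var Val Lbl V) (i : Fin n) (t : ℕ) (it : Item Var Val) : Prop :=
  r.prop t i ∧ ((r.state t).buf i).head? = some it

/-- `⟨i, t⟩` reads the entry `it` from the store buffer of `i`. -/
def IsRfB (r : Run n Var Val Lbl V) (i : Fin n) (t : ℕ) (it : Item Var Val) : Prop :=
  ∃ x, r.act t i = Act.read x ∧ lastItem ((r.state t).buf i) x = some it

/-- `⟨i, t⟩` reads `x` from memory. -/
def IsRfM (r : Run n Var Val Lbl V) (i : Fin n) (t : ℕ) (x : Var) : Prop :=
  r.act t i = Act.read x ∧ lastItem ((r.state t).buf i) x = none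

/-- `⟨i, t⟩` is a read-modify-write of `x`. -/
def IsRMW (r : Run n Var Val Lbl V) (i : Fin n) (t : ℕ) (x : Var) : Prop :=
  ∃ e w, r.act t i = Act.rmw x e w

/-- The action at node `⟨b, t⟩` is a memory access of the variable `x`. -/
def MemAccess (r : Run n Var Val Lbl V) (x : Var) : Node n → Prop
  | (Agent.proc i, t) => r.IsRfM i t x ∨ r.IsRMW i t x
  | (Agent.disp i, t) => ∃ it, r.IsProp i t it ∧ it.var = x

/-- The action at node `⟨b, t⟩` is a read from memory. -/
def NodeRfM (r : Run n Var Val Lbl V) : Node n → Prop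
  | (Agent.proc i, t) => ∃ x, r.IsRfM i t x
  | (Agent.disp _, _) => False

/-- The actions of the distinct agents `b` and `c` at time `t` are conflicting. -/
def Conflict (r : Run n Var Val Lbl V) (t : ℕ) (b c : Agent n) : Prop :=
  ¬ (r.NodeRfM (b, t) ∧ r.NodeRfM (c, t)) ∧
  (∃ x, r.MemAccess x (b, t) ∧ r.MemAccess x (c, t)) ∧
  ¬ (∃ i, (b = Agent.disp i ∧ c = Agent.proc i ∧ r.NodeRfM (c, t)) ∨
          (c = Agent.disp i ∧ b = Agent.proc i ∧ r.NodeRfM (b, t)))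

/-- The effect of the joint action of round `t + 1`.  The memory accesses of a round do not
conflict, so the order in which the actions of a round are carried out matters only for a store
buffer, where the process appends before its dispatcher removes. -/
structure Transition (r : Run n Var Val Lbl V) (t : ℕ) : Prop where
  loc : ∀ i, (r.state (t + 1)).loc i =
    (r.state t).loc i ++ (r.state t).record i (r.act t i) ++
      ((r.inv t i).map Rec.invoke).toList
  buf_prop : ∀ i, r.prop t i → (r.state (t + 1)).buf i =
    ((r.state t).buf i ++ (r.state t).newItems i (r.act t i)).tail
  buf_idle : ∀ i, ¬ r.prop t i → (r.state (t + 1)).buf i =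
    (r.state t).buf i ++ (r.state t).newItems i (r.act t i)
  mem_rmw : ∀ i x e w, r.act t i = Act.rmw x e w → (r.state (t + 1)).mem x = w
  mem_prop : ∀ i it, r.IsProp i t it → (r.state (t + 1)).mem it.var = it.val
  mem_idle : ∀ x, (∀ i, ¬ r.IsRMW i t x) → (∀ i it, r.IsProp i t it → it.var ≠ x) →
    (r.state (t + 1)).mem x = (r.state t).mem x

/-- `r` is a TSO run of the implementation `I`. -/
structure IsRunOf (r : Run n Var Val Lbl V) (I : RegImpl n Var Val Lbl V) : Prop where
  init_mem : (r.state 0).mem = I.init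
  init_buf : ∀ i, (r.state 0).buf i = []
  init_loc : ∀ i, (r.state 0).loc i = []
  enabled_act : ∀ t i, (r.state t).Enabled i (r.act t i)
  enabled_prop : ∀ t i, r.prop t i → (r.state t).buf i ≠ []
  no_conflict : ∀ t b c, b ≠ c → ¬ r.Conflict t b c
  transition : ∀ t, r.Transition t
  consistent : ∀ t i, r.act t i ≠ Act.null → r.act t i ∈ I.protocol i ((r.state t).loc i)

/-! ### The occurs-before relation -/

/-- `⟨i, t⟩` is a write, or a read from the buffer, with tag `⟨i, k⟩`. -/
def BufferTag (r : Run n Var Val Lbl V) (i : Fin n) (t k : ℕ) : Prop :=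
  (∃ x v, r.act t i = Act.write x v ∧ k = writeCount ((r.state t).loc i) + 1) ∨
  (∃ it, r.IsRfB i t it ∧ k = it.idx)

/-- `⟨d_i, t⟩` is a propagation with tag `⟨i, k⟩`. -/
def PropTag (r : Run n Var Val Lbl V) (i : Fin n) (t k : ℕ) : Prop :=
  ∃ it, r.IsProp i t it ∧ k = it.idx

/-- The occurs-before relation between the nodes of `r`. -/
inductive OB (r : Run n Var Val Lbl V) : Node n → Node n → Prop
  | locality (b : Agent n) (t t' : ℕ) (ht : t < t') : OB r (b, t) (b, t')
  | buffer (i : Fin n) (t t' k : ℕ) (ht : t < t')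
      (h : r.BufferTag i t k) (h' : r.PropTag i t' k) :
      OB r (Agent.proc i, t) (Agent.disp i, t')
  | access (b c : Agent n) (t t' : ℕ) (x : Var) (ht : t < t')
      (h : r.MemAccess x (b, t)) (h' : r.MemAccess x (c, t'))
      (notReads : ¬ (r.NodeRfM (b, t) ∧ r.NodeRfM (c, t')))
      (notOwn : ¬ ∃ i, b = Agent.disp i ∧ c = Agent.proc i ∧ r.NodeRfM (c, t')) :
      OB r (b, t) (c, t')
  | sync (i : Fin n) (t t' : ℕ) (ht : t < t') (h : r.prop t i)
      (h' : r.act t' i = Act.fence ∨ ∃ x, r.IsRMW i t' x) :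
      OB r (Agent.disp i, t) (Agent.proc i, t')
  | trans (θ η ζ : Node n) (h : OB r θ η) (h' : OB r η ζ) : OB r θ ζ

/-! ### Operations -/

end Run

/-- The name of an operation of a run: the process `i` at which it is invoked and its starting
time `t`, where the invocation takes place in round `t + 1`. -/
abbrev Op (n : ℕ) := Fin n × ℕ

namespace Run

variable {n : ℕ} {Var Val Lbl V : Type*}

/-- `X` is an operation of `r`. -/
def IsOp (r : Run n Var Val Lbl V) (X : Op n) : Prop := r.inv X.2 X.1 ≠ none

/-- The process of the operation `X` performs the matching response, with result `w`, in round
`e`: the first response in a round after that of the invocation. -/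
def Returns (r : Run n Var Val Lbl V) (X : Op n) (e : ℕ) (w : RegResp V) : Prop :=
  r.IsOp X ∧ ∃ s, e = s + 1 ∧ X.2 < s ∧ r.act s X.1 = Act.ret w ∧
    ∀ u w', X.2 < u → u < s → r.act u X.1 ≠ Act.ret w'

/-- The operation `X` completes in `r`. -/
def Completes (r : Run n Var Val Lbl V) (X : Op n) : Prop := ∃ e w, r.Returns X e w

/-- `X` precedes `Y` in real time: the ending time of `X` is smaller than the starting time
of `Y`. -/
def Precedes (r : Run n Var Val Lbl V) (X Y : Op n) : Prop :=
  r.IsOp Y ∧ ∃ e w, r.Returns X e w ∧ e < Y.2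

/-- `X` runs in isolation: no other operation of `r` is concurrent to it. -/
def Isolated (r : Run n Var Val Lbl V) (X : Op n) : Prop :=
  ∀ Z, r.IsOp Z → Z ≠ X → r.Precedes Z X ∨ r.Precedes X Z

/-- `X` is a `v`-operation: a write of `v`, or a read that returns `v`. -/
def IsValOp (r : Run n Var Val Lbl V) (X : Op n) (v : V) : Prop :=
  r.inv X.2 X.1 = some (RegOp.write v) ∨
  (r.inv X.2 X.1 = some RegOp.read ∧ ∃ e, r.Returns X e (RegResp.val v))

/-- `X` occurs before `Y`: the starting node of `X` occurs before the ending node of `Y`. -/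
def OpOB [DecidableEq Var] (r : Run n Var Val Lbl V) (X Y : Op n) : Prop :=
  ∃ e w, r.Returns Y e w ∧ r.OB (Agent.proc X.1, X.2) (Agent.proc Y.1, e)

/-- The conventions on the environment: a process is not invoked again before it has responded to
the previous invocation, every value is written at most once, and the default value `v₀`, which
the register holds initially, is not written. -/
structure WellFormed (r : Run n Var Val Lbl V) (v₀ : V) : Prop where
  sequential : ∀ i t t', t < t' → r.IsOp (i, t) → r.IsOp (i, t') →
    ∃ s w, t < s ∧ s < t' ∧ r.act s i = Act.ret w
  unique_write : ∀ (X Y : Op n) (v : V), r.inv X.2 X.1 = some (RegOp.write v) →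
    r.inv Y.2 Y.1 = some (RegOp.write v) → X = Y
  default_not_written : ∀ X : Op n, r.inv X.2 X.1 ≠ some (RegOp.write v₀)

/-- In no round does a process read from its store buffer the very entry that its dispatcher
propagates in that round. -/
def NoReadPropRace [DecidableEq Var] (r : Run n Var Val Lbl V) : Prop :=
  ∀ i t it, ¬ (r.IsRfB i t it ∧ r.IsProp i t it)

/-- `W` is a write of `v` in `r`. -/
def IsWriteOp (r : Run n Var Val Lbl V) (W : Op n) (v : V) : Prop :=
  r.inv W.2 W.1 = some (RegOp.write v)

/-- When the operations in `L` take effect in the order of their positions `pos`, the register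
holds `v` just before `X`: `v` was written by the most recent write, or it is the default value
and there is no earlier write. -/
def HoldsBefore (r : Run n Var Val Lbl V) (v₀ : V) (L : Set (Op n)) (pos : Op n → ℕ)
    (X : Op n) (v : V) : Prop :=
  (∃ W ∈ L, r.IsWriteOp W v ∧ pos W < pos X ∧
    ∀ W' ∈ L, ∀ v', r.IsWriteOp W' v' → pos W' < pos X → pos W' ≤ pos W) ∨
  (v = v₀ ∧ ∀ W ∈ L, ∀ v', r.IsWriteOp W v' → ¬ pos W < pos X)

/-- `r` is linearizable with respect to the register with default value `v₀`: all completed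
operations, with some of the pending ones, can be arranged in a sequence that respects real-time
order and in which all responses are those of a register. -/
def IsLinearizable (r : Run n Var Val Lbl V) (v₀ : V) : Prop :=
  ∃ (L : Set (Op n)) (pos : Op n → ℕ),
    (∀ X ∈ L, r.IsOp X) ∧
    (∀ X, r.Completes X → X ∈ L) ∧
    Set.InjOn pos L ∧
    (∀ X ∈ L, ∀ Y ∈ L, r.Precedes X Y → pos X < pos Y) ∧
    (∀ X e w, r.Returns X e w → r.inv X.2 X.1 = some RegOp.read →
      ∃ v, w = RegResp.val v ∧ r.HoldsBefore v₀ L pos X v) ∧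
    (∀ X e w v, r.Returns X e w → r.IsWriteOp X v → w = RegResp.ack)

end Run

namespace RegImpl

variable {n : ℕ} {Var Val Lbl V : Type*} [DecidableEq Var]

/-- `I` is a linearizable implementation of the register with default value `v₀`. -/
def Linearizable (I : RegImpl n Var Val Lbl V) (v₀ : V) : Prop :=
  ∀ r : Run n Var Val Lbl V, r.IsRunOf I → r.WellFormed v₀ → r.IsLinearizable v₀

/-- `I` is obstruction-free: whenever the operation `X` is pending at time `T` of a run, there is
a run that agrees with it up to time `T`, in which from then on no other process takes a step and
nothing is invoked, and in which `X` completes.  (Dispatchers may propagate.) -/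
def ObstructionFree (I : RegImpl n Var Val Lbl V) (v₀ : V) : Prop :=
  ∀ r : Run n Var Val Lbl V, r.IsRunOf I → r.WellFormed v₀ →
    ∀ (X : Op n) (T : ℕ), r.IsOp X → X.2 < T → (∀ e w, r.Returns X e w → T < e) →
      ∃ r' : Run n Var Val Lbl V, r'.IsRunOf I ∧
        (∀ t ≤ T, r'.state t = r.state t) ∧
        (∀ t < T, r'.act t = r.act t ∧ r'.prop t = r.prop t ∧ r'.inv t = r.inv t) ∧
        (∀ t, T ≤ t → ∀ i, r'.inv t i = none) ∧
        (∀ t, T ≤ t → ∀ i, i ≠ X.1 → r'.act t i = Act.null) ∧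
        r'.Completes X

end RegImpl

end TSO

set_option linter.unusedSectionVars false
namespace TSO

/-! ### Rounds and gluing of runs -/

namespace Run

variable {n : ℕ} {Var Val Lbl V : Type*} [DecidableEq Var]

/-! Suppose `X.s` does not occur before `Y.e`, and let `T` be the time at which `Y` ends. Since `Y`
is isolated, every other operation invoked before `T` has completed before `Y` starts.
Obstruction-freeness therefore allows the run to be cut off at `T` and continued by a completed read
`R` at the process of `Y` (`exists_extendsByRead`), and linearizability forces `R` to return `b`
(`isValOp_of_follows`).

Now delay all nodes in the occurs-before future of `X.s`, so that `X` starts only after `Y` has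
ended, let the delayed part catch up with time `T`, and then run `R` (`exists_delayed`). By
assumption, the process of `Y` is not delayed before `T`. Every process still makes the same
observations, so the result is a run of the same implementation, but in it `Y` precedes `X` and `X`
precedes `R`, with values `b`, `a`, `b`. As each value is written at most once, the times at which a
register holds `b` form an interval (`HoldsAt.between`), so `a = b`, a contradiction.

The main work is to show that delaying is harmless. A set of nodes closed under occurs-before
predecessors (`IsCut`) determines a global state (`cutState`): the memory writes of a variable are
totally ordered by occurs-before, so the cut contains an initial segment of them, and a buffer
consists of the entries written minus those propagated. If a sequence of cuts advances each agent by
at most its node at one common time of `r` per step, then it yields a valid run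
(`Advance.validRound_reschedule`). The delicate point is a read from memory: its own dispatcher is
not ordered before it, so the read may turn into a read from the buffer. The value stays the same,
since the entry concerned is the one that memory supplied in `r` (`readVal_of_rfm`). -/

/-- The conditions that `IsRunOf` imposes on round `t + 1`. -/
structure ValidRound (r : Run n Var Val Lbl V) (I : RegImpl n Var Val Lbl V) (t : ℕ) : Prop where
  enabled_act : ∀ i, (r.state t).Enabled i (r.act t i)
  enabled_prop : ∀ i, r.prop t i → (r.state t).buf i ≠ []
  no_conflict : ∀ b c, b ≠ c → ¬ r.Conflict t b c
  transition : r.Transition t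
  consistent : ∀ i, r.act t i ≠ Act.null → r.act t i ∈ I.protocol i ((r.state t).loc i)

theorem IsRunOf.validRound {r : Run n Var Val Lbl V} {I : RegImpl n Var Val Lbl V}
    (hr : r.IsRunOf I) (t : ℕ) : r.ValidRound I t :=
  ⟨hr.enabled_act t, hr.enabled_prop t, hr.no_conflict t, hr.transition t, hr.consistent t⟩

/-- Round `t + 1` of `r` is the same as round `u + 1` of `q`. -/
structure SameRound (r q : Run n Var Val Lbl V) (t u : ℕ) : Prop where
  state : r.state t = q.state u
  state_succ : r.state (t + 1) = q.state (u + 1)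
  act : r.act t = q.act u
  prop : r.prop t = q.prop u
  inv : r.inv t = q.inv u

namespace SameRound

variable {r q : Run n Var Val Lbl V} {t u : ℕ}

theorem isProp (h : SameRound r q t u) (i : Fin n) (it : Item Var Val) :
    r.IsProp i t it ↔ q.IsProp i u it := by
  simp only [IsProp, h.state, h.prop]

theorem isRfM (h : SameRound r q t u) (i : Fin n) (x : Var) : r.IsRfM i t x ↔ q.IsRfM i u x := by
  simp only [IsRfM, h.state, h.act]

theorem isRMW (h : SameRound r q t u) (i : Fin n) (x : Var) : r.IsRMW i t x ↔ q.IsRMW i u x := by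
  simp only [IsRMW, h.act]

theorem memAccess (h : SameRound r q t u) (x : Var) (b : Agent n) :
    r.MemAccess x (b, t) ↔ q.MemAccess x (b, u) := by
  cases b <;> simp only [MemAccess, h.isProp, h.isRfM, h.isRMW]

theorem nodeRfM (h : SameRound r q t u) (b : Agent n) :
    r.NodeRfM (b, t) ↔ q.NodeRfM (b, u) := by
  cases b <;> simp only [NodeRfM, h.isRfM]

/-- Validity of a round involves only the two adjacent states and the actions between them, so it
can be carried from one run to another at a different time. -/
theorem validRound {I : RegImpl n Var Val Lbl V} (h : SameRound r q t u)
    (hq : q.ValidRound I u) : r.ValidRound I t where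
  enabled_act := by rw [h.state, h.act]; exact hq.enabled_act
  enabled_prop := by rw [h.state, h.prop]; exact hq.enabled_prop
  no_conflict := by
    intro b c hbc
    have := hq.no_conflict b c hbc
    simpa only [Conflict, h.memAccess, h.nodeRfM] using this
  consistent := by rw [h.state, h.act]; exact hq.consistent
  transition :=
    { loc := by rw [h.state, h.state_succ, h.act, h.inv]; exact hq.transition.loc
      buf_prop := by
        rw [h.state, h.state_succ, h.act, h.prop]; exact hq.transition.buf_prop
      buf_idle := by
        rw [h.state, h.state_succ, h.act, h.prop]; exact hq.transition.buf_idle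
      mem_rmw := by rw [h.state_succ, h.act]; exact hq.transition.mem_rmw
      mem_prop := by
        simp only [h.isProp, h.state_succ]; exact hq.transition.mem_prop
      mem_idle := by
        simp only [h.isProp, h.isRMW, h.state, h.state_succ]; exact hq.transition.mem_idle }

end SameRound

/-- The first `A` rounds of `p`, followed by the rounds of `q` from time `B` on. -/
def glue (p : Run n Var Val Lbl V) (A : ℕ) (q : Run n Var Val Lbl V) (B : ℕ) :
    Run n Var Val Lbl V where
  state t := if t < A then p.state t else q.state (t - A + B)
  act t := if t < A then p.act t else q.act (t - A + B)
  prop t := if t < A then p.prop t else q.prop (t - A + B)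
  inv t := if t < A then p.inv t else q.inv (t - A + B)

theorem glue_validRound {p q : Run n Var Val Lbl V} {I : RegImpl n Var Val Lbl V} {A B : ℕ}
    (h : p.state A = q.state B) (hp : ∀ t < A, p.ValidRound I t)
    (hq : ∀ t, B ≤ t → q.ValidRound I t) (t : ℕ) : (p.glue A q B).ValidRound I t := by
  rcases lt_or_ge t A with ht | ht
  · refine SameRound.validRound (q := p) (u := t) ?_ (hp t ht)
    refine ⟨by simp [glue, ht], ?_, by simp [glue, ht], by simp [glue, ht], by simp [glue, ht]⟩
    rcases lt_or_ge (t + 1) A with ht' | ht'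
    · simp [glue, ht']
    -- The seam: the last round of `p` ends in a state taken from `q`, which is the right one by
    -- `h`.
    · obtain rfl : t + 1 = A := by omega
      simp [glue, h]
  · refine SameRound.validRound (q := q) (u := t - A + B) ?_ (hq _ (by omega))
    have h1 : ¬ t < A := by omega
    have h2 : ¬ t + 1 < A := by omega
    refine ⟨by simp [glue, h1], ?_, by simp [glue, h1], by simp [glue, h1], by simp [glue, h1]⟩
    simp only [glue, h2, if_false]
    congr 1; omega

theorem glue_isRunOf {p q : Run n Var Val Lbl V} {I : RegImpl n Var Val Lbl V} {A B : ℕ}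
    (h : p.state A = q.state B) (hmem : (p.state 0).mem = I.init)
    (hbuf : ∀ i, (p.state 0).buf i = []) (hloc : ∀ i, (p.state 0).loc i = [])
    (hp : ∀ t < A, p.ValidRound I t) (hq : ∀ t, B ≤ t → q.ValidRound I t) :
    (p.glue A q B).IsRunOf I := by
  have hv := glue_validRound h hp hq
  have h0 : (p.glue A q B).state 0 = p.state 0 := by
    rcases Nat.eq_zero_or_pos A with rfl | hA
    · simp [glue, h]
    · simp [glue, hA]
  exact ⟨by rw [h0, hmem], by rw [h0]; exact hbuf, by rw [h0]; exact hloc,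
    fun t => (hv t).enabled_act, fun t => (hv t).enabled_prop, fun t => (hv t).no_conflict,
    fun t => (hv t).transition, fun t => (hv t).consistent⟩

/-- A round in which nobody acts, and only invocations are recorded, is valid. -/
theorem validRound_of_idle {r : Run n Var Val Lbl V} (I : RegImpl n Var Val Lbl V) {t : ℕ}
    (hact : ∀ i, r.act t i = Act.null) (hprop : ∀ i, ¬ r.prop t i)
    (hbuf : (r.state (t + 1)).buf = (r.state t).buf)
    (hmem : (r.state (t + 1)).mem = (r.state t).mem)
    (hloc : ∀ i, (r.state (t + 1)).loc i =
      (r.state t).loc i ++ ((r.inv t i).map Rec.invoke).toList) : r.ValidRound I t where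
  enabled_act i := by rw [hact]; trivial
  enabled_prop i h := (hprop i h).elim
  no_conflict b c _ hc := by
    obtain ⟨x, h, -⟩ := hc.2.1
    cases b <;> simp [MemAccess, IsRfM, IsRMW, IsProp, hact, hprop] at h
  consistent i h := (h (hact i)).elim
  transition :=
    { loc := fun i => by simp [hloc, hact, GState.record]
      buf_prop := fun i h => (hprop i h).elim
      buf_idle := fun i _ => by simp [hbuf, hact, GState.newItems]
      mem_rmw := fun i x e w h => by simp [hact] at h
      mem_prop := fun i it h => (hprop i h.1).elim
      mem_idle := fun x _ _ => by rw [hmem] }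

end Run
end TSO

namespace TSO

/-! ### Store buffers as the written entries minus the propagated ones -/

section Items

variable {Var Val Lbl V : Type*}

theorem lastItem_append [DecidableEq Var] (β γ : List (Item Var Val)) (x : Var) :
    lastItem (β ++ γ) x = (lastItem γ x).or (lastItem β x) := by
  simp [lastItem, List.getLast?_append]

theorem lastItem_cons [DecidableEq Var] (it : Item Var Val) (β : List (Item Var Val)) (x : Var) :
    lastItem (it :: β) x = (lastItem β x).or (if it.var = x then some it else none) := by
  rw [← List.singleton_append, lastItem_append]
  congr 1
  by_cases h : it.var = x <;> simp [lastItem, h]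

theorem lastItem_eq_none [DecidableEq Var] {β : List (Item Var Val)} {x : Var} :
    lastItem β x = none ↔ ∀ it ∈ β, it.var ≠ x := by
  simp [lastItem]

theorem lastItem_mem [DecidableEq Var] {β : List (Item Var Val)} {x : Var} {it : Item Var Val}
    (h : lastItem β x = some it) : it ∈ β ∧ it.var = x := by
  have := List.mem_of_getLast? h
  simpa using this

/-- Dropping fewer entries only adds older ones, and these matter only if no newer entry for `x`
remains. -/
theorem lastItem_drop_of_le [DecidableEq Var] (β : List (Item Var Val)) (x : Var) {k l : ℕ}
    (h : k ≤ l) : ∃ o, lastItem (β.drop k) x = (lastItem (β.drop l) x).or o := by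
  refine ⟨lastItem ((β.drop k).take (l - k)) x, ?_⟩
  rw [← lastItem_append]
  congr 1
  conv_lhs => rw [← List.take_append_drop (l - k) (β.drop k)]
  rw [List.drop_drop, Nat.add_sub_cancel' h]

theorem writeCount_append (l l' : Local Var Val Lbl V) :
    writeCount (l ++ l') = writeCount l + writeCount l' := by
  induction l with
  | nil => simp [writeCount]
  | cons a l ih => cases a <;> simp [writeCount, ih]; omega

theorem GState.readVal_eq {n : ℕ} [DecidableEq Var] (σ : GState n Var Val Lbl V) (i : Fin n)
    (x : Var) : σ.readVal i x = (lastItem (σ.buf i) x).elim (σ.mem x) Item.val := by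
  unfold GState.readVal
  cases lastItem (σ.buf i) x <;> rfl

end Items

/-- A counting function that increases by at most one per step takes all intermediate values. -/
theorem exists_step_of_lt {f : ℕ → ℕ} (hf : ∀ t, f (t + 1) ≤ f t + 1) {s t k : ℕ}
    (hs : f s ≤ k) (ht : k < f t) (hst : s ≤ t) :
    ∃ u, s ≤ u ∧ u < t ∧ f u = k ∧ f (u + 1) = k + 1 := by
  induction t, hst using Nat.le_induction with
  | base => omega
  | succ t hst ih =>
    by_cases h : k < f t
    · obtain ⟨u, h1, h2, h3⟩ := ih h
      exact ⟨u, h1, by omega, h3⟩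
    · have := hf t
      exact ⟨t, hst, by omega, by omega, by omega⟩

namespace Run

variable {n : ℕ} {Var Val Lbl V : Type*} [DecidableEq Var]

/-- The entries that process `i` writes before time `t`, oldest first. -/
def writes (r : Run n Var Val Lbl V) (i : Fin n) : ℕ → List (Item Var Val)
  | 0 => []
  | t + 1 => r.writes i t ++ (r.state t).newItems i (r.act t i)

open Classical in
/-- The number of entries that `d_i` propagates before time `t`. -/
noncomputable def propCount (r : Run n Var Val Lbl V) (i : Fin n) : ℕ → ℕ
  | 0 => 0
  | t + 1 => r.propCount i t + if r.prop t i then 1 else 0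

variable {r : Run n Var Val Lbl V} {I : RegImpl n Var Val Lbl V}

theorem propCount_succ_of_prop {i : Fin n} {t : ℕ} (h : r.prop t i) :
    r.propCount i (t + 1) = r.propCount i t + 1 := by simp [propCount, h]

theorem propCount_succ_of_not {i : Fin n} {t : ℕ} (h : ¬ r.prop t i) :
    r.propCount i (t + 1) = r.propCount i t := by simp [propCount, h]

theorem propCount_succ_le (i : Fin n) (t : ℕ) :
    r.propCount i (t + 1) ≤ r.propCount i t + 1 := by
  by_cases h : r.prop t i
  · rw [propCount_succ_of_prop h]
  · rw [propCount_succ_of_not h]; omega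

theorem propCount_mono (r : Run n Var Val Lbl V) (i : Fin n) : Monotone (r.propCount i) :=
  monotone_nat_of_le_succ fun t => by
    by_cases h : r.prop t i
    · rw [propCount_succ_of_prop h]; omega
    · rw [propCount_succ_of_not h]

theorem writes_prefix (r : Run n Var Val Lbl V) (i : Fin n) {s t : ℕ} (h : s ≤ t) :
    r.writes i s <+: r.writes i t := by
  induction t, h using Nat.le_induction with
  | base => exact List.prefix_rfl
  | succ t _ ih => exact ih.trans (List.prefix_append _ _)

theorem newItems_length_le (σ : GState n Var Val Lbl V) (i : Fin n) (a : Act Var Val Lbl V) :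
    (σ.newItems i a).length ≤ 1 := by
  cases a <;> simp [GState.newItems]

theorem writeCount_record (σ : GState n Var Val Lbl V) (i : Fin n) (a : Act Var Val Lbl V) :
    writeCount (σ.record i a) = (σ.newItems i a).length := by
  cases a <;> simp [GState.newItems, GState.record, writeCount]

theorem IsRunOf.length_writes (hr : r.IsRunOf I) (i : Fin n) (t : ℕ) :
    (r.writes i t).length = writeCount ((r.state t).loc i) := by
  induction t with
  | zero => simp [writes, hr.init_loc, writeCount]
  | succ t ih =>
    rw [(hr.transition t).loc, writeCount_append, writeCount_append, writeCount_record, ← ih]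
    cases r.inv t i <;> simp [writes, writeCount]

/-- FIFO order makes the buffer a suffix of the list of all writes. The bound is proved in the same
induction because `drop` commutes with appending only below the length of the list. -/
theorem IsRunOf.propCount_le_and_buf (hr : r.IsRunOf I) (i : Fin n) (t : ℕ) :
    r.propCount i t ≤ (r.writes i t).length ∧
      (r.state t).buf i = (r.writes i t).drop (r.propCount i t) := by
  induction t with
  | zero => simp [writes, propCount, hr.init_buf]
  | succ t ih =>
    obtain ⟨ih1, ih2⟩ := ih
    by_cases h : r.prop t i
    · have h1 := hr.enabled_prop t i h
      have h2 : r.propCount i t < (r.writes i t).length := by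
        rw [ih2] at h1
        simpa using h1
      rw [(hr.transition t).buf_prop i h, ih2, propCount_succ_of_prop h]
      refine ⟨by simp only [writes, List.length_append]; omega, ?_⟩
      rw [writes, ← List.drop_append_of_le_length ih1, List.tail_drop]
    · rw [(hr.transition t).buf_idle i h, ih2, propCount_succ_of_not h]
      refine ⟨by simp only [writes, List.length_append]; omega, ?_⟩
      rw [writes, ← List.drop_append_of_le_length ih1]

theorem IsRunOf.propCount_le (hr : r.IsRunOf I) (i : Fin n) (t : ℕ) :
    r.propCount i t ≤ (r.writes i t).length := (hr.propCount_le_and_buf i t).1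

theorem IsRunOf.buf_eq (hr : r.IsRunOf I) (i : Fin n) (t : ℕ) :
    (r.state t).buf i = (r.writes i t).drop (r.propCount i t) := (hr.propCount_le_and_buf i t).2

theorem IsRunOf.propCount_lt (hr : r.IsRunOf I) {i : Fin n} {t : ℕ} (h : r.prop t i) :
    r.propCount i t < (r.writes i t).length := by
  have := hr.enabled_prop t i h
  rw [hr.buf_eq] at this
  simpa using this

theorem IsRunOf.idx_writes (hr : r.IsRunOf I) {i : Fin n} {t k : ℕ} {it : Item Var Val}
    (h : (r.writes i t)[k]? = some it) : it.idx = k + 1 := by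
  induction t with
  | zero => simp [writes] at h
  | succ t ih =>
    rw [writes, List.getElem?_append] at h
    split at h
    · exact ih h
    · cases ha : r.act t i <;> simp [ha, GState.newItems, List.getElem?_singleton] at h
      obtain ⟨h1, rfl⟩ := h
      simp only [← hr.length_writes]; omega

/-- The time `q` is independent of `t`, because in a cut a process and its dispatcher may stand at
different times. The propagated entry is determined by the dispatcher's count alone. -/
theorem IsRunOf.getElem?_writes_of_prop (hr : r.IsRunOf I) {i : Fin n} {t q : ℕ} (h : r.prop t i)
    (hq : r.propCount i t < (r.writes i q).length) :
    ∃ it, r.IsProp i t it ∧ (r.writes i q)[r.propCount i t]? = some it := by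
  have h1 := hr.propCount_lt h
  refine ⟨(r.writes i t)[r.propCount i t], ⟨h, ?_⟩, ?_⟩
  · rw [hr.buf_eq, List.head?_drop, List.getElem?_eq_getElem h1]
  · rw [List.getElem?_eq_getElem hq]
    rcases le_total q t with hle | hle
    · exact congrArg some ((writes_prefix r i hle).getElem hq)
    · exact congrArg some ((writes_prefix r i hle).getElem h1).symm

theorem IsRunOf.drop_propCount_of_prop (hr : r.IsRunOf I) {i : Fin n} {t q : ℕ} (h : r.prop t i)
    (hq : r.propCount i t < (r.writes i q).length) :
    ∃ it, r.IsProp i t it ∧ (r.writes i q).drop (r.propCount i t) =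
      it :: (r.writes i q).drop (r.propCount i (t + 1)) := by
  obtain ⟨it, h1, h2⟩ := hr.getElem?_writes_of_prop h hq
  refine ⟨it, h1, ?_⟩
  rw [List.getElem?_eq_getElem hq] at h2
  rw [List.drop_eq_getElem_cons hq, Option.some.inj h2, propCount_succ_of_prop h]

theorem IsRunOf.propTag (hr : r.IsRunOf I) {i : Fin n} {t : ℕ} (h : r.prop t i) :
    r.PropTag i t (r.propCount i t + 1) := by
  obtain ⟨it, h1, h2⟩ := hr.getElem?_writes_of_prop h (hr.propCount_lt h)
  exact ⟨it, h1, (hr.idx_writes h2).symm⟩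

theorem IsProp.unique {i : Fin n} {t : ℕ} {it it' : Item Var Val} (h : r.IsProp i t it)
    (h' : r.IsProp i t it') : it = it' :=
  Option.some.inj (h.2.symm.trans h'.2)

/-! ### Memory writes -/

/-- The action at the node changes the variable `x` in memory: a read-modify-write of `x` or
a propagation of an entry for `x`. -/
def MemWrite (r : Run n Var Val Lbl V) (x : Var) : Node n → Prop
  | (Agent.proc i, t) => r.IsRMW i t x
  | (Agent.disp i, t) => ∃ it, r.IsProp i t it ∧ it.var = x

theorem MemWrite.memAccess {x : Var} {θ : Node n} (h : r.MemWrite x θ) : r.MemAccess x θ := by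
  obtain ⟨b | b, t⟩ := θ
  · exact Or.inr h
  · exact h

theorem MemWrite.not_nodeRfM {x : Var} {θ : Node n} (h : r.MemWrite x θ) : ¬ r.NodeRfM θ := by
  obtain ⟨b | b, t⟩ := θ
  · rintro ⟨y, h1, -⟩
    obtain ⟨e, w, h2⟩ := h
    rw [h1] at h2
    cases h2
  · exact id

theorem MemWrite.ob {x : Var} {b c : Agent n} {t t' : ℕ} (h : r.MemWrite x (b, t))
    (h' : r.MemWrite x (c, t')) (ht : t < t') : r.OB (b, t) (c, t') :=
  .access b c t t' x ht h.memAccess h'.memAccess (fun H => h.not_nodeRfM H.1)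
    fun ⟨_, _, _, H⟩ => h'.not_nodeRfM H

theorem IsRunOf.memWrite_agent_unique (hr : r.IsRunOf I) {x : Var} {b c : Agent n} {t : ℕ}
    (h : r.MemWrite x (b, t)) (h' : r.MemWrite x (c, t)) : b = c := by
  by_contra hne
  refine hr.no_conflict t b c hne ⟨fun H => h.not_nodeRfM H.1, ⟨x, h.memAccess, h'.memAccess⟩, ?_⟩
  rintro ⟨i, ⟨-, -, H⟩ | ⟨-, -, H⟩⟩
  · exact h'.not_nodeRfM H
  · exact h.not_nodeRfM H

/-- The absence of conflicts excludes every agent but the reader's own dispatcher. If that one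
propagated an entry for `x`, the entry would be in the buffer and the read would not go to memory.
-/
theorem IsRfM.no_memWrite (hr : r.IsRunOf I) {x : Var} {i : Fin n} {t : ℕ}
    (h : r.IsRfM i t x) (b : Agent n) : ¬ r.MemWrite x (b, t) := by
  intro hw
  have hne : b ≠ Agent.proc i := by
    rintro rfl
    exact hw.not_nodeRfM ⟨x, h⟩
  refine hr.no_conflict t b (Agent.proc i) hne
    ⟨fun H => hw.not_nodeRfM H.1, ⟨x, hw.memAccess, Or.inl h⟩, ?_⟩
  rintro ⟨j, ⟨rfl, hj, -⟩ | ⟨hj, -⟩⟩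
  · cases hj
    obtain ⟨it, hp, hx⟩ := hw
    exact lastItem_eq_none.1 h.2 it (List.mem_of_mem_head? hp.2) hx
  · cases hj

theorem Transition.mem_eq {t : ℕ} (h : r.Transition t) {x : Var}
    (hx : ∀ b, ¬ r.MemWrite x (b, t)) : (r.state (t + 1)).mem x = (r.state t).mem x :=
  h.mem_idle x (fun i => hx (Agent.proc i)) fun i it hp hv => hx (Agent.disp i) ⟨it, hp, hv⟩

theorem IsRunOf.mem_eq (hr : r.IsRunOf I) {x : Var} {s t : ℕ} (hst : s ≤ t)
    (hx : ∀ b u, s ≤ u → u < t → ¬ r.MemWrite x (b, u)) :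
    (r.state t).mem x = (r.state s).mem x := by
  induction t, hst using Nat.le_induction with
  | base => rfl
  | succ t hst ih =>
    rw [(hr.transition t).mem_eq fun b => hx b t hst (Nat.lt_succ_self t)]
    exact ih fun b u h1 h2 => hx b u h1 (by omega)

/-- Propagations of entries for other variables do not change the newest entry for `x`. -/
theorem IsRunOf.lastItem_drop_eq (hr : r.IsRunOf I) {i : Fin n} {x : Var} {s t q : ℕ}
    (hst : s ≤ t) (htq : t ≤ q)
    (hx : ∀ u, s ≤ u → u < t → ¬ r.MemWrite x (Agent.disp i, u)) :
    lastItem ((r.writes i q).drop (r.propCount i s)) x =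
      lastItem ((r.writes i q).drop (r.propCount i t)) x := by
  induction t, hst using Nat.le_induction with
  | base => rfl
  | succ t hst ih =>
    rw [ih (by omega) fun u h1 h2 => hx u h1 (by omega)]
    by_cases h : r.prop t i
    · obtain ⟨it, h1, h2⟩ := hr.drop_propCount_of_prop (q := q) h
        ((hr.propCount_lt h).trans_le (writes_prefix r i (by omega)).length_le)
      rw [h2, lastItem_cons, if_neg fun hv => hx t hst (Nat.lt_succ_self t) ⟨it, h1, hv⟩,
        Option.or_none]
    · rw [propCount_succ_of_not h]

/-- As long as no other agent writes `x` to memory, the value of `x` seen by process `i` does not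
depend on the propagations of `d_i`. -/
theorem IsRunOf.seen_eq (hr : r.IsRunOf I) {i : Fin n} {x : Var} {s t q : ℕ}
    (hst : s ≤ t) (htq : t ≤ q)
    (hx : ∀ b u, s ≤ u → u < t → r.MemWrite x (b, u) → b = Agent.disp i) :
    (lastItem ((r.writes i q).drop (r.propCount i s)) x).elim ((r.state s).mem x) Item.val =
    (lastItem ((r.writes i q).drop (r.propCount i t)) x).elim ((r.state t).mem x) Item.val := by
  induction t, hst using Nat.le_induction with
  | base => rfl
  | succ t hst ih =>
    rw [ih (by omega) fun b u h1 h2 => hx b u h1 (by omega)]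
    by_cases h : r.prop t i
    · obtain ⟨it, h1, h2⟩ := hr.drop_propCount_of_prop (q := q) h
        ((hr.propCount_lt h).trans_le (writes_prefix r i (by omega)).length_le)
      rw [h2, lastItem_cons]
      -- An entry for `x` moves from the buffer to memory: if a newer one remains, it is seen before
      -- and after; otherwise the moved value is seen in memory.
      by_cases hv : it.var = x
      · have hm := (hr.transition t).mem_prop i it h1
        rw [hv] at hm
        rw [if_pos hv, hm]
        cases lastItem ((r.writes i q).drop (r.propCount i (t + 1))) x <;> rfl
      · rw [if_neg hv, Option.or_none, (hr.transition t).mem_eq]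
        intro b hb
        obtain rfl := hx b t hst (Nat.lt_succ_self t) hb
        obtain ⟨it', h3, h4⟩ := hb
        exact hv (h1.unique h3 ▸ h4)
    · rw [propCount_succ_of_not h, (hr.transition t).mem_eq]
      intro b hb
      obtain rfl := hx b t hst (Nat.lt_succ_self t) hb
      obtain ⟨it', h3, h4⟩ := hb
      exact h h3.1

end Run
end TSO

namespace TSO

/-! ### Consistent cuts -/

namespace Run

variable {n : ℕ} {Var Val Lbl V : Type*} [DecidableEq Var]
variable {r : Run n Var Val Lbl V} {I : RegImpl n Var Val Lbl V}

/-- The cut `p`, which contains the node `⟨b, t⟩` iff `t < p b`, is bounded, and closed under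
predecessors in the occurs-before relation. -/
structure IsCut (r : Run n Var Val Lbl V) (p : Agent n → ℕ) : Prop where
  closed : ∀ b u c u', r.OB (b, u) (c, u') → u' < p c → u < p b
  bounded : ∃ T, ∀ b, p b ≤ T

/-- The memory writes of `x` in the cut `p` are those before time `m`. -/
def SplitsAt (r : Run n Var Val Lbl V) (p : Agent n → ℕ) (x : Var) (m : ℕ) : Prop :=
  ∀ b u, r.MemWrite x (b, u) → (u < p b ↔ u < m)

/-- Memory writes of `x` at different times are ordered by occurs-before, and no two share a time. A
cut thus contains an initial segment of them; `m` is the time of the first one outside, or a bound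
of the cut if there is none. -/
theorem IsRunOf.exists_splitsAt (hr : r.IsRunOf I) {p : Agent n → ℕ} (hp : r.IsCut p) (x : Var) :
    ∃ m, r.SplitsAt p x m := by
  classical
  by_cases h : ∃ u b, r.MemWrite x (b, u) ∧ p b ≤ u
  · obtain ⟨c, hc, hpc⟩ := Nat.find_spec h
    refine ⟨Nat.find h, fun b u hw => ⟨fun hu => ?_, fun hu => ?_⟩⟩
    · by_contra hle
      rcases (not_lt.1 hle).eq_or_lt with heq | hlt
      · rw [← heq] at hw
        obtain rfl := hr.memWrite_agent_unique hw hc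
        omega
      · have := hp.closed _ _ _ _ (hc.ob hw hlt) hu
        omega
    · by_contra hle
      exact Nat.find_min h hu ⟨b, hw, not_lt.1 hle⟩
  · push Not at h
    obtain ⟨T, hT⟩ := hp.bounded
    exact ⟨T, fun b u hw => ⟨fun hu => hu.trans_le (hT b), fun _ => h u b hw⟩⟩

theorem SplitsAt.mem_eq (hr : r.IsRunOf I) {p : Agent n → ℕ} {x : Var} {m m' : ℕ}
    (h : r.SplitsAt p x m) (h' : r.SplitsAt p x m') :
    (r.state m).mem x = (r.state m').mem x := by
  wlog hle : m' ≤ m generalizing m m'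
  · exact (this h' h (by omega)).symm
  refine hr.mem_eq hle fun b u h1 h2 hw => ?_
  have := (h' b u hw).1 ((h b u hw).2 h2)
  omega

open Classical in
/-- The global state reached when exactly the nodes of the cut `p` have been executed. -/
noncomputable def cutState (r : Run n Var Val Lbl V) (p : Agent n → ℕ) : GState n Var Val Lbl V where
  -- For a cut the default is never used, by `exists_splitsAt`, and the choice of `m` is immaterial,
  -- by `SplitsAt.mem_eq`.
  mem x := if h : ∃ m, r.SplitsAt p x m then (r.state h.choose).mem x else (r.state 0).mem x
  buf i := (r.writes i (p (Agent.proc i))).drop (r.propCount i (p (Agent.disp i)))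
  loc i := (r.state (p (Agent.proc i))).loc i

theorem IsRunOf.cutState_mem (hr : r.IsRunOf I) {p : Agent n → ℕ} {x : Var} {m : ℕ}
    (h : r.SplitsAt p x m) : (r.cutState p).mem x = (r.state m).mem x := by
  have hex : ∃ m, r.SplitsAt p x m := ⟨m, h⟩
  simp only [cutState, dif_pos hex]
  exact hex.choose_spec.mem_eq hr h

theorem IsRunOf.cutState_const (hr : r.IsRunOf I) (t : ℕ) :
    r.cutState (fun _ => t) = r.state t := by
  have h1 : (r.cutState (fun _ => t)).mem = (r.state t).mem :=
    funext fun x => hr.cutState_mem fun b u _ => Iff.rfl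
  have h2 : (r.cutState (fun _ => t)).buf = (r.state t).buf :=
    funext fun i => (hr.buf_eq i t).symm
  have h3 : (r.cutState (fun _ => t)).loc = (r.state t).loc := rfl
  cases hs : r.state t
  rw [hs] at h1 h2 h3
  cases hc : r.cutState (fun _ => t)
  rw [hc] at h1 h2 h3
  simp_all

theorem OB.lt {θ η : Node n} (h : r.OB θ η) : θ.2 < η.2 := by
  induction h with
  | trans _ _ _ _ _ h1 h2 => exact h1.trans h2
  | _ => assumption

theorem isCut_const (r : Run n Var Val Lbl V) (t : ℕ) : r.IsCut fun _ => t :=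
  ⟨fun _ _ _ _ h hu => h.lt.trans hu, t, fun _ => le_rfl⟩

theorem IsCut.min {p q : Agent n → ℕ} (hp : r.IsCut p) (hq : r.IsCut q) :
    r.IsCut fun b => min (p b) (q b) := by
  refine ⟨fun b u c u' h hu => ?_, ?_⟩
  · have h1 := hp.closed b u c u' h
    have h2 := hq.closed b u c u' h
    omega
  · obtain ⟨T, hT⟩ := hp.bounded
    exact ⟨T, fun b => (min_le_left _ _).trans (hT b)⟩

theorem IsCut.max {p q : Agent n → ℕ} (hp : r.IsCut p) (hq : r.IsCut q) :
    r.IsCut fun b => max (p b) (q b) := by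
  refine ⟨fun b u c u' h hu => ?_, ?_⟩
  · have h1 := hp.closed b u c u' h
    have h2 := hq.closed b u c u' h
    omega
  · obtain ⟨T, hT⟩ := hp.bounded
    obtain ⟨T', hT'⟩ := hq.bounded
    exact ⟨T ⊔ T', fun b => max_le_max (hT b) (hT' b)⟩

/-- A write occurs before the propagation of its entry, so a dispatcher cannot overtake its process
inside a cut. -/
theorem IsCut.propCount_le (hr : r.IsRunOf I) {p : Agent n → ℕ} (hp : r.IsCut p) (i : Fin n) :
    r.propCount i (p (Agent.disp i)) ≤ (r.writes i (p (Agent.proc i))).length := by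
  by_contra! hlt
  obtain ⟨u, -, hu, hu1, hu2⟩ := exists_step_of_lt (f := r.propCount i)
    (propCount_succ_le i) (Nat.zero_le _) hlt (Nat.zero_le _)
  have hprop : r.prop u i := by
    by_contra h
    rw [propCount_succ_of_not h] at hu2
    omega
  have h1 := hr.propCount_lt hprop
  have hle : p (Agent.proc i) ≤ u := by
    by_contra! h
    have := (writes_prefix r i h.le).length_le
    omega
  rw [hu1] at h1
  obtain ⟨w, hw, hwu, hw1, hw2⟩ := exists_step_of_lt (f := fun t => (r.writes i t).length)
    (fun t => by
      have := newItems_length_le (r.state t) i (r.act t i)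
      simp only [writes, List.length_append]; omega) le_rfl h1 hle
  have hact : ∃ x v, r.act w i = Act.write x v := by
    rw [writes, List.length_append, hw1] at hw2
    cases ha : r.act w i <;> simp [ha, GState.newItems] at hw2 ⊢
  obtain ⟨x, v, hact⟩ := hact
  have hob : r.OB (Agent.proc i, w) (Agent.disp i, u) :=
    .buffer i w u (r.propCount i u + 1) hwu
      (Or.inl ⟨x, v, hact, by rw [← hr.length_writes, hu1, hw1]⟩)
      (hr.propTag hprop)
  have := hp.closed _ _ _ _ hob hu
  omega

/-! ### Advancing a cut -/

/-- The cut `p'` results from `p` by executing the nodes at time `t` of some agents. -/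
structure Advance (r : Run n Var Val Lbl V) (p p' : Agent n → ℕ) (t : ℕ) : Prop where
  isCut : r.IsCut p
  isCut' : r.IsCut p'
  step : ∀ b, p' b = p b ∨ p b = t ∧ p' b = t + 1

namespace Advance

variable {p p' : Agent n → ℕ} {t : ℕ}

/-- The node being executed is itself a memory write of `x`, hence comparable with all others: the
earlier ones are already in the cut, the later ones are not. -/
theorem splitsAt (hr : r.IsRunOf I) (h : r.Advance p p' t) {x : Var} {b : Agent n}
    (hw : r.MemWrite x (b, t)) (hb : p b = t) (hb' : p' b = t + 1) :
    r.SplitsAt p x t ∧ r.SplitsAt p' x (t + 1) := by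
  have key : ∀ c u, r.MemWrite x (c, u) → (u < p c ↔ u < t) ∧ (u < p' c ↔ u < t + 1) := by
    intro c u hc
    have hs := h.step c
    rcases lt_trichotomy u t with hu | rfl | hu
    · have := h.isCut'.closed _ _ _ _ (hc.ob hw hu) (by omega)
      omega
    · obtain rfl := hr.memWrite_agent_unique hc hw
      omega
    · have := h.isCut.closed _ _ _ _ (hw.ob hc hu)
      omega
  exact ⟨fun c u hc => (key c u hc).1, fun c u hc => (key c u hc).2⟩

theorem rfm_writes_lt (hr : r.IsRunOf I) (h : r.Advance p p' t) {i : Fin n} {x : Var}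
    (hi : p (Agent.proc i) = t) (hrf : r.IsRfM i t x) {b : Agent n} {u : ℕ}
    (hw : r.MemWrite x (b, u)) (hu : u < p b) : u < t := by
  rcases lt_trichotomy u t with h1 | rfl | h1
  · exact h1
  · exact (hrf.no_memWrite hr b hw).elim
  · have : r.OB (Agent.proc i, t) (b, u) :=
      .access _ _ _ _ x h1 (Or.inl hrf) hw.memAccess (fun H => hw.not_nodeRfM H.2)
        fun ⟨_, H, _⟩ => by cases H
    have := h.isCut.closed _ _ _ _ this hu
    omega

/-- The reader's own dispatcher must be excluded: its propagations do not occur before the read by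
the access rule, so the cut may lack them. -/
theorem lt_of_rfm (h : r.Advance p p' t) {i : Fin n} {x : Var}
    (hi' : p' (Agent.proc i) = t + 1) (hrf : r.IsRfM i t x) {b : Agent n} {u : ℕ}
    (hw : r.MemWrite x (b, u)) (hu : u < t) (hb : b ≠ Agent.disp i) : u < p b := by
  have : r.OB (b, u) (Agent.proc i, t) :=
    .access _ _ _ _ x hu hw.memAccess (Or.inl hrf) (fun H => hw.not_nodeRfM H.1)
      fun ⟨j, H, H', _⟩ => by cases H'; exact hb H
  have := h.isCut'.closed _ _ _ _ this (by omega)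
  have := h.step b
  omega

/-- A read from the buffer reads the same entry in the state of the cut. -/
theorem lastItem_of_rfb (hr : r.IsRunOf I) (hrace : r.NoReadPropRace) (h : r.Advance p p' t)
    {i : Fin n} {x : Var} (hi : p (Agent.proc i) = t)
    (hact : r.act t i = Act.read x) {it : Item Var Val}
    (hit : lastItem ((r.state t).buf i) x = some it) :
    lastItem ((r.cutState p).buf i) x = some it := by
  have hrfb : r.IsRfB i t it := ⟨x, hact, hit⟩
  rw [hr.buf_eq] at hit
  simp only [cutState, hi]
  -- A lagging dispatcher only leaves older entries in the buffer. If it is ahead, the entry must be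
  -- shown to be still there: its propagation at the time of the read is excluded by `hrace`, and a
  -- later one has the read as a predecessor, which is not yet in the cut.
  rcases le_total (p (Agent.disp i)) t with hle | hle
  · obtain ⟨o, ho⟩ := lastItem_drop_of_le (r.writes i t) x (propCount_mono r i hle)
    rw [ho, hit, Option.some_or]
  · obtain ⟨o, ho⟩ := lastItem_drop_of_le (r.writes i t) x (propCount_mono r i hle)
    rw [hit] at ho
    cases hc : lastItem ((r.writes i t).drop (r.propCount i (p (Agent.disp i)))) x with
    | some it' => rw [hc, Option.some_or] at ho; exact ho.symm
    | none =>
      exfalso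
      obtain ⟨hmem, hx⟩ := lastItem_mem hit
      obtain ⟨k, hk⟩ := List.mem_iff_getElem?.1 hmem
      rw [List.getElem?_drop] at hk
      set l := r.propCount i t + k
      have hl : l < r.propCount i (p (Agent.disp i)) := by
        by_contra! hge
        refine lastItem_eq_none.1 hc it (List.mem_iff_getElem?.2
          ⟨l - r.propCount i (p (Agent.disp i)), ?_⟩) hx
        rw [List.getElem?_drop, Nat.add_sub_cancel' hge, hk]
      obtain ⟨u, htu, hu, hu1, hu2⟩ := exists_step_of_lt (f := r.propCount i)
        (propCount_succ_le i) (Nat.le_add_right _ _) hl hle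
      have hprop : r.prop u i := by
        by_contra hn
        rw [propCount_succ_of_not hn] at hu2
        omega
      rcases htu.eq_or_lt with rfl | htu
      · obtain ⟨it', h1, h2⟩ := hr.getElem?_writes_of_prop (q := t) hprop (hr.propCount_lt hprop)
        rw [hu1, hk] at h2
        cases h2
        exact hrace i t it ⟨hrfb, h1⟩
      · have hob : r.OB (Agent.proc i, t) (Agent.disp i, u) :=
          .buffer i t u (l + 1) htu (Or.inr ⟨it, hrfb, (hr.idx_writes hk).symm⟩)
            (by simp only [l, ← hu1]; exact hr.propTag hprop)
        have := h.isCut.closed _ _ _ _ hob hu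
        omega

/-- A read from memory returns the same value in the state of the cut, where it may have become a
read from the buffer. -/
theorem readVal_of_rfm (hr : r.IsRunOf I) (h : r.Advance p p' t) {i : Fin n} {x : Var}
    (hi : p (Agent.proc i) = t) (hi' : p' (Agent.proc i) = t + 1) (hrf : r.IsRfM i t x) :
    (r.cutState p).readVal i x = (r.state t).readVal i x := by
  have hlt := fun b u => h.rfm_writes_lt hr hi hrf (b := b) (u := u)
  have hin := fun b u => h.lt_of_rfm hi' hrf (b := b) (u := u)
  obtain ⟨m, hm⟩ := hr.exists_splitsAt h.isCut x
  rw [GState.readVal_eq, GState.readVal_eq, hr.buf_eq, hr.cutState_mem hm]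
  have hnone := hrf.2
  rw [hr.buf_eq] at hnone
  simp only [cutState, hi]
  set d := p (Agent.disp i) with hd
  -- If the dispatcher lags, its missing propagations for `x` are replaced by buffer entries:
  -- between `max m d` and `t` only `d_i` writes `x`, so `seen_eq` applies, while the stretch
  -- between `m` and `d` changes nothing. If it is not behind, the buffer has no entry for `x` and
  -- the cut splits at `t`.
  rcases le_total d t with hle | hle
  · rcases le_total t m with htm | htm
    · rw [hr.lastItem_drop_eq hle le_rfl, hr.mem_eq htm]
      · intro b u h1 h2 hw
        have := hlt b u hw ((hm b u hw).2 h2)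
        omega
      · intro u h1 h2 hw
        have := (hm _ u hw).2 (by omega)
        omega
    rcases le_total m d with hmd | hmd
    · rw [← hr.mem_eq hmd]
      · refine hr.seen_eq hle le_rfl fun b u h1 h2 hw => ?_
        by_contra hb
        have := (hm b u hw).1 (hin b u hw h2 hb)
        omega
      · intro b u h1 h2 hw
        by_cases hb : b = Agent.disp i
        · subst hb
          have := (hm _ u hw).1 h2
          omega
        · have := (hm b u hw).1 (hin b u hw (by omega) hb)
          omega
    · rw [hr.lastItem_drop_eq hmd htm]
      · refine hr.seen_eq htm le_rfl fun b u h1 h2 hw => ?_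
        by_contra hb
        have := (hm b u hw).1 (hin b u hw h2 hb)
        omega
      · intro u h1 h2 hw
        have := (hm _ u hw).2 h2
        omega
  · obtain ⟨o, ho⟩ := lastItem_drop_of_le (r.writes i t) x (propCount_mono r i hle)
    rw [hnone, eq_comm, Option.or_eq_none_iff] at ho
    rw [hnone, ho.1]
    refine hm.mem_eq hr fun b u hw => ⟨hlt b u hw, fun hu => ?_⟩
    by_cases hb : b = Agent.disp i
    · subst hb; omega
    · exact hin b u hw hu hb

/-- By the `sync` rule, all propagations of `d_i` before a fence or RMW lie in the cut, so the
buffer is empty there too. The memory value expected by an RMW comes from `splitsAt`. -/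
theorem enabled (hr : r.IsRunOf I) (h : r.Advance p p' t) {i : Fin n}
    (hi : p (Agent.proc i) = t) (hi' : p' (Agent.proc i) = t + 1) :
    (r.cutState p).Enabled i (r.act t i) := by
  have hbuf : (r.act t i = Act.fence ∨ ∃ x, r.IsRMW i t x) → (r.state t).buf i = [] →
      (r.cutState p).buf i = [] := by
    intro hsync hempty
    rw [hr.buf_eq, List.drop_eq_nil_iff] at hempty
    simp only [cutState, List.drop_eq_nil_iff, hi]
    rcases le_total t (p (Agent.disp i)) with hle | hle
    · exact hempty.trans (propCount_mono r i hle)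
    · refine hempty.trans (le_of_eq ?_)
      by_contra hne
      obtain ⟨u, h1, h2, h3, h4⟩ := exists_step_of_lt (f := r.propCount i) (propCount_succ_le i)
        le_rfl (lt_of_le_of_ne (propCount_mono r i hle) (Ne.symm hne)) hle
      have hprop : r.prop u i := by
        by_contra hn
        rw [propCount_succ_of_not hn] at h4
        omega
      have := h.isCut'.closed _ _ _ _ (OB.sync i u t h2 hprop hsync) (by omega)
      have := h.step (Agent.disp i)
      omega
  have hen := hr.enabled_act t i
  cases ha : r.act t i with
  | fence =>
    rw [ha] at hen
    exact hbuf (Or.inl ha) hen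
  | rmw x e w =>
    rw [ha] at hen
    have hw : r.MemWrite x (Agent.proc i, t) := ⟨e, w, ha⟩
    exact ⟨hbuf (Or.inr ⟨x, hw⟩) hen.1,
      by rw [hr.cutState_mem (h.splitsAt hr hw hi hi').1]; exact hen.2⟩
  | _ => trivial

theorem record_eq (hr : r.IsRunOf I) (hrace : r.NoReadPropRace) (h : r.Advance p p' t)
    {i : Fin n} (hi : p (Agent.proc i) = t) (hi' : p' (Agent.proc i) = t + 1) :
    (r.cutState p).record i (r.act t i) = (r.state t).record i (r.act t i) := by
  cases ha : r.act t i with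
  | read x =>
    simp only [GState.record]
    congr 2
    cases hl : lastItem ((r.state t).buf i) x with
    | none => exact h.readVal_of_rfm hr hi hi' ⟨ha, hl⟩
    | some it =>
      rw [GState.readVal_eq, GState.readVal_eq, hl, h.lastItem_of_rfb hr hrace hi ha hl]
      rfl
  | _ => rfl

theorem newItems_eq (hi : p (Agent.proc i) = t) :
    (r.cutState p).newItems i (r.act t i) = (r.state t).newItems i (r.act t i) := by
  cases ha : r.act t i <;> simp only [GState.newItems, cutState, hi]

/-- The entry is present before the round, not merely after the process has appended to its buffer.
If the process stands still, this is the bound for `p'`; if it advances, it stands at time `t`, as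
in `r`. -/
theorem propCount_lt (hr : r.IsRunOf I) (h : r.Advance p p' t) {i : Fin n}
    (hi' : p' (Agent.disp i) = t + 1) (hprop : r.prop t i) :
    r.propCount i t < (r.writes i (p (Agent.proc i))).length := by
  rcases h.step (Agent.proc i) with h1 | h1
  · have := h.isCut'.propCount_le hr i
    rw [hi', h1, propCount_succ_of_prop hprop] at this
    omega
  · rw [h1.1]
    exact hr.propCount_lt hprop

theorem head?_buf (hr : r.IsRunOf I) (h : r.Advance p p' t) {i : Fin n}
    (hi : p (Agent.disp i) = t) (hi' : p' (Agent.disp i) = t + 1) (hprop : r.prop t i) :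
    ((r.cutState p).buf i).head? = ((r.state t).buf i).head? := by
  obtain ⟨it, h1, h2⟩ := hr.getElem?_writes_of_prop hprop (h.propCount_lt hr hi' hprop)
  rw [h1.2]
  simp only [cutState, List.head?_drop, hi, h2]

end Advance

/-! ### Rescheduling a run -/

open Classical in
/-- The run that executes the nodes of `r` according to the sequence `c` of cuts; the agents that
advance at time `t` execute their nodes at time `ρ t` of `r`. -/
noncomputable def reschedule (r : Run n Var Val Lbl V) (c : ℕ → Agent n → ℕ) (ρ : ℕ → ℕ) :
    Run n Var Val Lbl V where
  state t := r.cutState (c t)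
  act t i := if c (t + 1) (Agent.proc i) = c t (Agent.proc i) then Act.null else r.act (ρ t) i
  prop t i := c (t + 1) (Agent.disp i) ≠ c t (Agent.disp i) ∧ r.prop (ρ t) i
  inv t i := if c (t + 1) (Agent.proc i) = c t (Agent.proc i) then none else r.inv (ρ t) i

section

variable {c : ℕ → Agent n → ℕ} {ρ : ℕ → ℕ} {t : ℕ}

theorem Advance.isProp_reschedule (hr : r.IsRunOf I) (h : r.Advance (c t) (c (t + 1)) (ρ t))
    {i : Fin n} {it : Item Var Val} : (r.reschedule c ρ).IsProp i t it ↔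
      c (t + 1) (Agent.disp i) ≠ c t (Agent.disp i) ∧ r.IsProp i (ρ t) it := by
  simp only [IsProp, reschedule]
  rw [and_assoc]
  refine and_congr_right fun h1 => and_congr_right fun h2 => ?_
  have h3 := (h.step (Agent.disp i)).resolve_left h1
  rw [h.head?_buf hr h3.1 h3.2 h2]

theorem isRMW_reschedule {i : Fin n} {x : Var} : (r.reschedule c ρ).IsRMW i t x ↔
    c (t + 1) (Agent.proc i) ≠ c t (Agent.proc i) ∧ r.IsRMW i (ρ t) x := by
  by_cases h1 : c (t + 1) (Agent.proc i) = c t (Agent.proc i) <;>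
    simp [IsRMW, reschedule, h1]

theorem Advance.memWrite_reschedule (hr : r.IsRunOf I) (h : r.Advance (c t) (c (t + 1)) (ρ t))
    {b : Agent n} {x : Var} : (r.reschedule c ρ).MemWrite x (b, t) ↔
      c (t + 1) b ≠ c t b ∧ r.MemWrite x (b, ρ t) := by
  cases b with
  | proc i => exact isRMW_reschedule
  | disp i => simp only [MemWrite, h.isProp_reschedule hr, and_assoc, exists_and_left]

theorem Advance.isRfM_of_reschedule (hr : r.IsRunOf I) (hrace : r.NoReadPropRace)
    (h : r.Advance (c t) (c (t + 1)) (ρ t)) {i : Fin n} {x : Var}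
    (hx : (r.reschedule c ρ).IsRfM i t x) :
    c (t + 1) (Agent.proc i) ≠ c t (Agent.proc i) ∧ r.IsRfM i (ρ t) x := by
  obtain ⟨h1, h2⟩ := hx
  by_cases hadv : c (t + 1) (Agent.proc i) = c t (Agent.proc i)
  · simp [reschedule, hadv] at h1
  · simp only [reschedule, if_neg hadv] at h1 h2
    refine ⟨hadv, h1, ?_⟩
    by_contra hne
    obtain ⟨it, hit⟩ := Option.ne_none_iff_exists'.1 hne
    have h3 := (h.step (Agent.proc i)).resolve_left hadv
    rw [h.lastItem_of_rfb hr hrace h3.1 h1 hit] at h2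
    cases h2

/-- Rescheduling can remove memory accesses, when a read from memory becomes a read from the buffer,
but creates none. The second part preserves both exemptions in `Conflict`, so no new conflict
arises. -/
theorem Advance.memAccess_of_reschedule (hr : r.IsRunOf I) (hrace : r.NoReadPropRace)
    (h : r.Advance (c t) (c (t + 1)) (ρ t)) {b : Agent n} {x : Var}
    (hx : (r.reschedule c ρ).MemAccess x (b, t)) :
    r.MemAccess x (b, ρ t) ∧ (r.NodeRfM (b, ρ t) → (r.reschedule c ρ).NodeRfM (b, t)) := by
  cases b with
  | proc i =>
    rcases hx with hx | hx
    · exact ⟨Or.inl (h.isRfM_of_reschedule hr hrace hx).2, fun _ => ⟨x, hx⟩⟩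
    · have hw : r.MemWrite x (Agent.proc i, ρ t) := (isRMW_reschedule.1 hx).2
      exact ⟨hw.memAccess, fun H => (hw.not_nodeRfM H).elim⟩
  | disp i => exact ⟨((h.memWrite_reschedule hr (b := Agent.disp i)).1 hx).2, id⟩

theorem Advance.validRound_reschedule (hr : r.IsRunOf I) (hrace : r.NoReadPropRace)
    (h : r.Advance (c t) (c (t + 1)) (ρ t)) : (r.reschedule c ρ).ValidRound I t where
  enabled_act i := by
    by_cases hadv : c (t + 1) (Agent.proc i) = c t (Agent.proc i)
    · simp only [reschedule, if_pos hadv]; trivial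
    · have h3 := (h.step (Agent.proc i)).resolve_left hadv
      simp only [reschedule, if_neg hadv]
      exact h.enabled hr h3.1 h3.2
  enabled_prop i hp := by
    have h3 := (h.step (Agent.disp i)).resolve_left hp.1
    have := h.propCount_lt hr h3.2 hp.2
    simpa [reschedule, cutState, h3.1] using this
  no_conflict b b' hb hconf := by
    obtain ⟨h1, ⟨x, h2, h2'⟩, h3⟩ := hconf
    have h4 := h.memAccess_of_reschedule hr hrace h2
    have h4' := h.memAccess_of_reschedule hr hrace h2'
    refine hr.no_conflict (ρ t) b b' hb ⟨fun H => h1 ⟨h4.2 H.1, h4'.2 H.2⟩,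
      ⟨x, h4.1, h4'.1⟩, fun ⟨i, H⟩ => h3 ⟨i, ?_⟩⟩
    exact H.imp (fun ⟨e, e', H⟩ => ⟨e, e', h4'.2 H⟩) fun ⟨e, e', H⟩ => ⟨e, e', h4.2 H⟩
  consistent i hne := by
    by_cases hadv : c (t + 1) (Agent.proc i) = c t (Agent.proc i)
    · simp [reschedule, hadv] at hne
    · have h3 := (h.step (Agent.proc i)).resolve_left hadv
      simp only [reschedule, if_neg hadv] at hne ⊢
      simp only [cutState, h3.1]
      exact hr.consistent _ i hne
  transition := by
    have hbuf : ∀ i, (r.writes i (c (t + 1) (Agent.proc i))) =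
        r.writes i (c t (Agent.proc i)) ++ ((r.reschedule c ρ).state t).newItems i
          ((r.reschedule c ρ).act t i) := by
      intro i
      by_cases hadv : c (t + 1) (Agent.proc i) = c t (Agent.proc i)
      · simp [reschedule, hadv, GState.newItems]
      · have h3 := (h.step (Agent.proc i)).resolve_left hadv
        simp only [reschedule, if_neg hadv]
        rw [newItems_eq h3.1, h3.1, h3.2]
        rfl
    have hmw : ∀ x b, (r.reschedule c ρ).MemWrite x (b, t) →
        (r.cutState (c (t + 1))).mem x = (r.state (ρ t + 1)).mem x := by
      intro x b hw
      obtain ⟨hadv, hw⟩ := (h.memWrite_reschedule hr).1 hw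
      have h3 := (h.step b).resolve_left hadv
      exact hr.cutState_mem (h.splitsAt hr hw h3.1 h3.2).2
    constructor
    case loc =>
      intro i
      by_cases hadv : c (t + 1) (Agent.proc i) = c t (Agent.proc i)
      · simp [reschedule, hadv, GState.record, cutState]
      · have h3 := (h.step (Agent.proc i)).resolve_left hadv
        simp only [reschedule, if_neg hadv]
        rw [h.record_eq hr hrace h3.1 h3.2]
        simp only [cutState, h3.1, h3.2]
        exact (hr.transition _).loc i
    case buf_prop =>
      intro i hp
      have h3 := (h.step (Agent.disp i)).resolve_left hp.1
      have h4 := h.propCount_lt hr h3.2 hp.2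
      have h5 := hbuf i
      simp only [reschedule, cutState] at h5 ⊢
      rw [h5, h3.1, h3.2, propCount_succ_of_prop hp.2, ← List.tail_drop,
        List.drop_append_of_le_length h4.le]
    case buf_idle =>
      intro i hp
      have h4 := h.isCut.propCount_le hr i
      have h5 := hbuf i
      have h6 : r.propCount i (c (t + 1) (Agent.disp i)) =
          r.propCount i (c t (Agent.disp i)) := by
        by_cases hadv : c (t + 1) (Agent.disp i) = c t (Agent.disp i)
        · rw [hadv]
        · have h3 := (h.step (Agent.disp i)).resolve_left hadv
          rw [h3.1, h3.2, propCount_succ_of_not fun H => hp ⟨hadv, H⟩]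
      simp only [reschedule, cutState] at h5 ⊢
      rw [h5, h6, List.drop_append_of_le_length h4]
    case mem_rmw =>
      intro i x e w ha
      have hw : (r.reschedule c ρ).MemWrite x (Agent.proc i, t) := ⟨e, w, ha⟩
      refine (hmw x _ hw).trans ((hr.transition _).mem_rmw i x e w ?_)
      have hadv := (isRMW_reschedule.1 hw).1
      simpa [reschedule, hadv] using ha
    case mem_prop =>
      intro i it hp
      have hw : (r.reschedule c ρ).MemWrite it.var (Agent.disp i, t) := ⟨it, hp, rfl⟩
      exact (hmw _ _ hw).trans
        ((hr.transition _).mem_prop i it ((h.isProp_reschedule hr).1 hp).2)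
    case mem_idle =>
      intro x h1 h2
      obtain ⟨m, hm⟩ := hr.exists_splitsAt h.isCut x
      -- None of the nodes executed in this step writes `x`, so the old `m` also splits the new cut.
      refine (hr.cutState_mem (m := m) fun b u hw => ?_).trans (hr.cutState_mem hm).symm
      rw [← hm b u hw]
      by_cases hadv : c (t + 1) b = c t b
      · rw [hadv]
      · have h3 := (h.step b).resolve_left hadv
        have hne : u ≠ ρ t := by
          rintro rfl
          have hw' := (h.memWrite_reschedule hr).2 ⟨hadv, hw⟩
          cases b with
          | proc i => exact h1 i hw'
          | disp i =>
            obtain ⟨it, hp, hv⟩ := hw'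
            exact h2 i it hp hv
        omega

end

end Run
end TSO

namespace TSO

/-! ### Delaying the future of a node -/

namespace Run

section Delay

variable {n : ℕ} {Var Val Lbl V : Type*} [DecidableEq Var]

/-- For every process `i`, the behavior in `r'` is that in `q` with `Δ` idle rounds inserted at
time `s i`. -/
structure InsertsIdle (q r' : Run n Var Val Lbl V) (s : Fin n → ℕ) (Δ : ℕ) : Prop where
  before : ∀ i u, u < s i → r'.act u i = q.act u i ∧ r'.inv u i = q.inv u i
  idle : ∀ i u, s i ≤ u → u < s i + Δ → r'.act u i = Act.null ∧ r'.inv u i = none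
  after : ∀ i u, s i ≤ u → r'.act (u + Δ) i = q.act u i ∧ r'.inv (u + Δ) i = q.inv u i

/-- The cuts through which a run passes if everything outside the cut `τ` is delayed by `Δ`. -/
def delayCut (τ : Agent n → ℕ) (Δ t : ℕ) (b : Agent n) : ℕ :=
  if t < Δ then min t (τ b) else max (t - Δ) (τ b)

/-- Before time `Δ` only the nodes in `τ` are executed, which is enough time since `T ≤ Δ`; then the
others follow, `Δ` late. At time `T + Δ` the cut is everything before `T`, so `q` can take over. -/
theorem exists_delayed {r q : Run n Var Val Lbl V} {I : RegImpl n Var Val Lbl V}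
    (hr : r.IsRunOf I) (hrace : r.NoReadPropRace) (hq : q.IsRunOf I) {T Δ : ℕ}
    (hstate : q.state T = r.state T)
    (hagree : ∀ t < T, q.act t = r.act t ∧ q.inv t = r.inv t)
    {τ : Agent n → ℕ} (hτ : r.IsCut τ) (hτT : ∀ b, τ b ≤ T) (hΔ : T ≤ Δ) (hpos : 0 < Δ) :
    ∃ r' : Run n Var Val Lbl V, r'.IsRunOf I ∧
      InsertsIdle q r' (fun i => τ (Agent.proc i)) Δ := by
  set ρ : ℕ → ℕ := fun t => if t < Δ then t else t - Δ with hρ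
  set p := r.reschedule (delayCut τ Δ) ρ with hp
  have hcut : ∀ t, r.IsCut (delayCut τ Δ t) := by
    intro t
    by_cases ht : t < Δ
    · convert (r.isCut_const t).min hτ using 1
      funext b; simp [delayCut, ht]
    · convert (r.isCut_const (t - Δ)).max hτ using 1
      funext b; simp [delayCut, ht]
  have hadv : ∀ t, r.Advance (delayCut τ Δ t) (delayCut τ Δ (t + 1)) (ρ t) := fun t =>
    ⟨hcut t, hcut _, fun b => by
      have := hτT b
      simp only [delayCut, hρ]
      split_ifs <;> omega⟩
  have h0 : p.state 0 = r.state 0 := by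
    rw [← hr.cutState_const 0]
    simp only [hp, reschedule]
    congr 1
    funext b; simp [delayCut, hpos]
  have hend : p.state (T + Δ) = q.state T := by
    rw [hstate, ← hr.cutState_const T]
    simp only [hp, reschedule]
    congr 1
    funext b; simp [delayCut, hτT b]
  refine ⟨p.glue (T + Δ) q T, glue_isRunOf hend (by rw [h0, hr.init_mem])
    (by rw [h0]; exact hr.init_buf) (by rw [h0]; exact hr.init_loc)
    (fun t _ => (hadv t).validRound_reschedule hr hrace) (fun t _ => hq.validRound t), ?_⟩
  refine ⟨fun i u hu => ?_, fun i u hu hu' => ?_, fun i u hu => ?_⟩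
  all_goals
    have hi := hτT (Agent.proc i)
  · have h1 : u < T + Δ := by omega
    have h2 : ¬ delayCut τ Δ (u + 1) (Agent.proc i) = delayCut τ Δ u (Agent.proc i) := by
      simp only [delayCut]; split_ifs <;> omega
    have h3 : ρ u = u := if_pos (by omega)
    obtain ⟨h4, h5⟩ := hagree u (by omega)
    simp [glue, h1, hp, reschedule, h2, h3, h4, h5]
  · have h1 : u < T + Δ := by omega
    have h2 : delayCut τ Δ (u + 1) (Agent.proc i) = delayCut τ Δ u (Agent.proc i) := by
      simp only [delayCut]; split_ifs <;> omega
    simp [glue, h1, hp, reschedule, h2]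
  · rcases lt_or_ge u T with h1 | h1
    · have h2 : ¬ delayCut τ Δ (u + Δ + 1) (Agent.proc i) = delayCut τ Δ (u + Δ) (Agent.proc i) := by
        simp only [delayCut]; split_ifs <;> omega
      have h3 : ρ (u + Δ) = u := by simp [hρ]
      obtain ⟨h4, h5⟩ := hagree u h1
      simp [glue, h1, hp, reschedule, h2, h3, h4, h5]
    · have h2 : u + Δ - (T + Δ) + T = u := by omega
      simp [glue, not_lt.2 h1, h2]

end Delay

variable {n : ℕ} {Var Val Lbl V : Type*}

/-! ### Operations of the delayed run -/

namespace InsertsIdle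

variable {q r' : Run n Var Val Lbl V} {s : Fin n → ℕ} {Δ : ℕ}

/-- The time in the delayed run of the round at time `u` of a process delayed from `s` on. -/
def shift (s Δ u : ℕ) : ℕ := if u < s then u else u + Δ

theorem shift_lt {s Δ u v : ℕ} : shift s Δ u < shift s Δ v ↔ u < v := by
  simp only [shift]; split_ifs <;> omega

theorem act_shift (h : InsertsIdle q r' s Δ) (i : Fin n) (u : ℕ) :
    r'.act (shift (s i) Δ u) i = q.act u i := by
  unfold shift
  split_ifs with hu
  · exact (h.before i u hu).1
  · exact (h.after i u (not_lt.1 hu)).1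

theorem inv_shift (h : InsertsIdle q r' s Δ) (i : Fin n) (u : ℕ) :
    r'.inv (shift (s i) Δ u) i = q.inv u i := by
  unfold shift
  split_ifs with hu
  · exact (h.before i u hu).2
  · exact (h.after i u (not_lt.1 hu)).2

theorem eq_shift_or_idle (h : InsertsIdle q r' s Δ) (i : Fin n) (t : ℕ) :
    (∃ u, t = shift (s i) Δ u) ∨ r'.act t i = Act.null ∧ r'.inv t i = none := by
  rcases lt_or_ge t (s i) with h1 | h1
  · exact Or.inl ⟨t, by simp [shift, h1]⟩
  rcases lt_or_ge t (s i + Δ) with h2 | h2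
  · exact Or.inr (h.idle i t h1 h2)
  · exact Or.inl ⟨t - Δ, by simp only [shift]; split_ifs <;> omega⟩

theorem eq_shift_of_inv (h : InsertsIdle q r' s Δ) {i : Fin n} {t : ℕ}
    (ht : r'.inv t i ≠ none) : ∃ u, t = shift (s i) Δ u :=
  (h.eq_shift_or_idle i t).resolve_right fun H => ht H.2

theorem wellFormed (h : InsertsIdle q r' s Δ) {v₀ : V} (hq : q.WellFormed v₀) :
    r'.WellFormed v₀ where
  sequential i t t' htt' ht ht' := by
    obtain ⟨u, rfl⟩ := h.eq_shift_of_inv (i := i) (t := t) ht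
    obtain ⟨u', rfl⟩ := h.eq_shift_of_inv (i := i) (t := t') ht'
    obtain ⟨z, w, h1, h2, h3⟩ := hq.sequential i u u' (shift_lt.1 htt')
      (by simpa only [IsOp, h.inv_shift] using ht) (by simpa only [IsOp, h.inv_shift] using ht')
    exact ⟨shift (s i) Δ z, w, shift_lt.2 h1, shift_lt.2 h2, by rw [h.act_shift, h3]⟩
  unique_write := by
    rintro ⟨i, t⟩ ⟨j, t'⟩ v hX hY
    obtain ⟨u, rfl⟩ := h.eq_shift_of_inv (i := i) (t := t) (by simp only at hX; simp [hX])
    obtain ⟨u', rfl⟩ := h.eq_shift_of_inv (i := j) (t := t') (by simp only at hY; simp [hY])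
    simp only [h.inv_shift] at hX hY
    have := hq.unique_write (i, u) (j, u') v hX hY
    cases this
    rfl
  default_not_written := by
    rintro ⟨i, t⟩ hX
    obtain ⟨u, rfl⟩ := h.eq_shift_of_inv (i := i) (t := t) (by simp only at hX; simp [hX])
    simp only [h.inv_shift] at hX
    exact hq.default_not_written (i, u) hX

/-- The operation of the delayed run that corresponds to `X`. -/
def shiftOp (s : Fin n → ℕ) (Δ : ℕ) (X : Op n) : Op n := (X.1, shift (s X.1) Δ X.2)

theorem inv_shiftOp (h : InsertsIdle q r' s Δ) (X : Op n) :
    r'.inv (shiftOp s Δ X).2 (shiftOp s Δ X).1 = q.inv X.2 X.1 := h.inv_shift _ _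

/-- The ending time is shifted through the index `z` of the response action and not through `z + 1`:
if the delay sets in exactly at `z + 1`, the response itself is not delayed. -/
theorem returns (h : InsertsIdle q r' s Δ) {X : Op n} {z : ℕ} {w : RegResp V}
    (hX : q.Returns X (z + 1) w) :
    r'.Returns (shiftOp s Δ X) (shift (s X.1) Δ z + 1) w := by
  obtain ⟨h1, z', h2, h3, h4, h5⟩ := hX
  obtain rfl : z = z' := by omega
  refine ⟨by rw [IsOp, h.inv_shiftOp]; exact h1, shift (s X.1) Δ z, rfl, shift_lt.2 h3,
    by rw [← h4]; exact h.act_shift _ _, fun u w' hu hu' hact => ?_⟩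
  rcases h.eq_shift_or_idle X.1 u with ⟨u, rfl⟩ | ⟨H, -⟩
  · exact h5 u w' (shift_lt.1 hu) (shift_lt.1 hu') (by rw [← hact]; exact (h.act_shift _ _).symm)
  · exact absurd (hact.symm.trans H) (by simp)

theorem isValOp (h : InsertsIdle q r' s Δ) {X : Op n} {v : V} (hX : q.IsValOp X v) :
    r'.IsValOp (shiftOp s Δ X) v := by
  rcases hX with hX | ⟨hX, e, he⟩
  · exact Or.inl (by rw [h.inv_shiftOp, hX])
  · refine Or.inr ⟨by rw [h.inv_shiftOp, hX], ?_⟩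
    obtain ⟨z, rfl⟩ : ∃ z, e = z + 1 := ⟨_, he.2.choose_spec.1⟩
    exact ⟨_, h.returns he⟩

end InsertsIdle

/-! ### Linearizations of a register -/

variable {r : Run n Var Val Lbl V}

theorem Returns.unique {X : Op n} {e e' : ℕ} {w w' : RegResp V} (h : r.Returns X e w)
    (h' : r.Returns X e' w') : e = e' ∧ w = w' := by
  obtain ⟨-, s, rfl, h1, h2, h3⟩ := h
  obtain ⟨-, s', rfl, h1', h2', h3'⟩ := h'
  obtain rfl : s = s' := by
    rcases lt_trichotomy s s' with h | h | h
    · exact (h3' s w h1 h h2).elim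
    · exact h
    · exact (h3 s' w' h1' h h2').elim
  exact ⟨rfl, by simpa using h2.symm.trans h2'⟩

/-- When the operations in `L` take effect in the order of their positions, the register holds `v`
after those at positions up to `k`. -/
def HoldsAt (r : Run n Var Val Lbl V) (v₀ : V) (L : Set (Op n)) (pos : Op n → ℕ) (k : ℕ)
    (v : V) : Prop :=
  (∃ W ∈ L, r.IsWriteOp W v ∧ pos W ≤ k ∧
    ∀ W' ∈ L, ∀ v', r.IsWriteOp W' v' → pos W' ≤ k → pos W' ≤ pos W) ∨
  (v = v₀ ∧ ∀ W ∈ L, ∀ v', r.IsWriteOp W v' → ¬ pos W ≤ k)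

variable {v₀ : V} {L : Set (Op n)} {pos : Op n → ℕ}

theorem IsWriteOp.value_unique {W : Op n} {v v' : V} (h : r.IsWriteOp W v)
    (h' : r.IsWriteOp W v') : v = v' := by
  simpa [IsWriteOp] using (show r.inv W.2 W.1 = _ from h).symm.trans h'

theorem HoldsAt.unique (hinj : Set.InjOn pos L) {k : ℕ} {v v' : V}
    (h : r.HoldsAt v₀ L pos k v) (h' : r.HoldsAt v₀ L pos k v') : v = v' := by
  rcases h with ⟨W, h1, h2, h3, h4⟩ | ⟨h1, h2⟩ <;> rcases h' with ⟨W', h1', h2', h3', h4'⟩ | ⟨h1', h2'⟩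
  · obtain rfl := hinj h1 h1' (le_antisymm (h4' W h1 v h2 h3) (h4 W' h1' v' h2' h3'))
    exact h2.value_unique h2'
  · exact (h2' W h1 v h2 h3).elim
  · exact (h2 W' h1' v' h2' h3').elim
  · exact h1.trans h1'.symm

theorem HoldsAt.of_le {k l : ℕ} {v : V} (h : r.HoldsAt v₀ L pos k v) (hkl : k ≤ l)
    (hW : ∀ W ∈ L, ∀ v', r.IsWriteOp W v' → pos W ≤ l → pos W ≤ k) :
    r.HoldsAt v₀ L pos l v := by
  rcases h with ⟨W, h1, h2, h3, h4⟩ | ⟨h1, h2⟩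
  · exact Or.inl ⟨W, h1, h2, h3.trans hkl, fun W' h5 v' h6 h7 => h4 W' h5 v' h6 (hW W' h5 v' h6 h7)⟩
  · exact Or.inr ⟨h1, fun W h3 v' h4 h5 => h2 W h3 v' h4 (hW W h3 v' h4 h5)⟩

/-- Since every value is written at most once, the positions where the register holds a given value
form an interval. -/
theorem HoldsAt.between (hwf : r.WellFormed v₀) {k l m : ℕ} {v : V}
    (hk : r.HoldsAt v₀ L pos k v) (hl : r.HoldsAt v₀ L pos l v) (hkm : k ≤ m) (hml : m ≤ l) :
    r.HoldsAt v₀ L pos m v := by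
  refine hk.of_le hkm ?_
  -- Both ends owe `v` to the same write, so no write lies between them. If `v` is the default,
  -- there is no write at all up to `l`.
  rcases hl with ⟨W, h1, h2, h3, h4⟩ | ⟨-, h2⟩
  · rcases hk with ⟨W', h1', h2', h3', -⟩ | ⟨rfl, -⟩
    · obtain rfl := hwf.unique_write W W' v h2 h2'
      exact fun U hU v' hv' hm => (h4 U hU v' hv' (hm.trans hml)).trans h3'
    · exact (hwf.default_not_written W h2).elim
  · exact fun U hU v' hv' hm => (h2 U hU v' hv' (hm.trans hml)).elim

/-- `(L, pos)` is a linearization of `r`. -/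
structure IsLinearization (r : Run n Var Val Lbl V) (v₀ : V) (L : Set (Op n))
    (pos : Op n → ℕ) : Prop where
  isOp : ∀ X ∈ L, r.IsOp X
  completes : ∀ X, r.Completes X → X ∈ L
  injOn : Set.InjOn pos L
  precedes : ∀ X ∈ L, ∀ Y ∈ L, r.Precedes X Y → pos X < pos Y
  read : ∀ X e w, r.Returns X e w → r.inv X.2 X.1 = some RegOp.read →
    ∃ v, w = RegResp.val v ∧ r.HoldsBefore v₀ L pos X v

theorem IsLinearizable.exists_isLinearization (h : r.IsLinearizable v₀) :
    ∃ L pos, r.IsLinearization v₀ L pos := by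
  obtain ⟨L, pos, h1, h2, h3, h4, h5, -⟩ := h
  exact ⟨L, pos, h1, h2, h3, h4, h5⟩

theorem HoldsBefore.holdsAt (hinj : Set.InjOn pos L) {X : Op n} {v : V}
    (hX : r.inv X.2 X.1 = some RegOp.read) (hXL : X ∈ L) (h : r.HoldsBefore v₀ L pos X v) :
    r.HoldsAt v₀ L pos (pos X) v := by
  have hlt : ∀ W ∈ L, ∀ v', r.IsWriteOp W v' → pos W ≤ pos X → pos W < pos X := by
    intro W hW v' hv' hle
    refine hle.lt_of_ne fun heq => ?_
    obtain rfl := hinj hW hXL heq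
    simp [IsWriteOp, hX] at hv'
  rcases h with ⟨W, h1, h2, h3, h4⟩ | ⟨h1, h2⟩
  · exact Or.inl ⟨W, h1, h2, h3.le, fun W' h5 v' h6 h7 => h4 W' h5 v' h6 (hlt W' h5 v' h6 h7)⟩
  · exact Or.inr ⟨h1, fun W h3 v' h4 h5 => h2 W h3 v' h4 (hlt W h3 v' h4 h5)⟩

/-- Reads and writes become uniform: the register holds `v` at the position of any completed
`v`-operation, which is all that the arguments below use. -/
theorem IsValOp.holdsAt (hL : r.IsLinearization v₀ L pos) {X : Op n} {v : V}
    (hX : r.IsValOp X v) (hc : r.Completes X) : r.HoldsAt v₀ L pos (pos X) v := by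
  have hXL := hL.completes X hc
  rcases hX with hX | ⟨hX, e, he⟩
  · exact Or.inl ⟨X, hXL, hX, le_rfl, fun _ _ _ _ h => h⟩
  · obtain ⟨v', h1, h2⟩ := hL.read X e _ he hX
    cases h1
    exact h2.holdsAt hL.injOn hX hXL

theorem Precedes.completes {X Y : Op n} (h : r.Precedes X Y) : r.Completes X :=
  let ⟨_, e, w, he, _⟩ := h
  ⟨e, w, he⟩

/-- An operation on a value `a` cannot run between two operations on another value. -/
theorem IsLinearizable.eq_of_precedes (h : r.IsLinearizable v₀) (hwf : r.WellFormed v₀)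
    {X Y R : Op n} {a b : V} (hY : r.IsValOp Y b) (hX : r.IsValOp X a) (hR : r.IsValOp R b)
    (hYX : r.Precedes Y X) (hXR : r.Precedes X R) (hRc : r.Completes R) : a = b := by
  obtain ⟨L, pos, hL⟩ := h.exists_isLinearization
  have hm := hL.completes
  exact (hX.holdsAt hL hXR.completes).unique hL.injOn <|
    (hY.holdsAt hL hYX.completes).between hwf (hR.holdsAt hL hRc)
      (hL.precedes Y (hm _ hYX.completes) X (hm _ hXR.completes) hYX).le
      (hL.precedes X (hm _ hXR.completes) R (hm _ hRc) hXR).le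

/-- A read that follows a `b`-operation `Y`, when all other operations precede `Y`, returns `b`. -/
theorem IsLinearizable.isValOp_of_follows (h : r.IsLinearizable v₀) {Y R : Op n} {b : V}
    (hY : r.IsValOp Y b) (hR : r.inv R.2 R.1 = some RegOp.read) (hYR : r.Precedes Y R)
    (hRc : r.Completes R) (hother : ∀ Z, r.IsOp Z → Z ≠ Y → Z ≠ R → r.Precedes Z Y) :
    r.IsValOp R b := by
  obtain ⟨L, pos, hL⟩ := h.exists_isLinearization
  have hYL := hL.completes Y hYR.completes
  have hRL := hL.completes R hRc
  obtain ⟨e, w, he⟩ := hRc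
  obtain ⟨v, rfl, hv⟩ := hL.read R e w he hR
  have hb : r.HoldsAt v₀ L pos (pos R) b := by
    refine (hY.holdsAt hL hYR.completes).of_le (hL.precedes Y hYL R hRL hYR).le ?_
    intro W hW v' hv' _
    by_cases h1 : W = Y
    · rw [h1]
    have h2 : W ≠ R := by
      rintro rfl
      simp [IsWriteOp, hR] at hv'
    exact (hL.precedes W hW Y hYL (hother W (hL.isOp W hW) h1 h2)).le
  obtain rfl := (hv.holdsAt hL.injOn hR hRL).unique hL.injOn hb
  exact Or.inr ⟨hR, e, he⟩

end Run
end TSO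

namespace TSO

/-! ### Appending a read to a finite part of a run -/

namespace Run

variable {n : ℕ} {Var Val Lbl V : Type*}

/-- Starting in `σ`, nobody acts, and a read is invoked at process `j` in the second round. -/
def idleRead (σ : GState n Var Val Lbl V) (j : Fin n) : Run n Var Val Lbl V where
  state t := { σ with
    loc := fun i => σ.loc i ++ if 2 ≤ t ∧ i = j then [Rec.invoke RegOp.read] else [] }
  act _ _ := Act.null
  prop _ _ := False
  inv t i := if t = 1 ∧ i = j then some RegOp.read else none

variable [DecidableEq Var]

theorem idleRead_validRound (σ : GState n Var Val Lbl V) (j : Fin n)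
    (I : RegImpl n Var Val Lbl V) (t : ℕ) : (idleRead σ j).ValidRound I t := by
  refine validRound_of_idle I (fun _ => rfl) (fun _ => id) rfl rfl fun i => ?_
  simp only [idleRead]
  by_cases hi : i = j
  · rcases t with _ | _ | t <;> simp [hi]
  · simp [hi]

/-- `q` agrees with `r` before time `T`, and the only invocation from then on is that of a read at
process `j` in round `T + 2`. -/
structure ExtendsByRead (r q : Run n Var Val Lbl V) (T : ℕ) (j : Fin n) : Prop where
  act : ∀ t < T, q.act t = r.act t
  inv : ∀ t < T, q.inv t = r.inv t
  inv_read : q.inv (T + 1) j = some RegOp.read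
  inv_none : ∀ t i, T ≤ t → (i, t) ≠ (j, T + 1) → q.inv t i = none

namespace ExtendsByRead

variable {r q : Run n Var Val Lbl V} {T : ℕ} {j : Fin n}

theorem lt_or_eq (h : ExtendsByRead r q T j) {X : Op n} (hX : q.IsOp X) :
    X.2 < T ∧ r.IsOp X ∨ X = (j, T + 1) := by
  rcases lt_or_ge X.2 T with h1 | h1
  · exact Or.inl ⟨h1, by rw [IsOp, ← h.inv _ h1]; exact hX⟩
  · right
    by_contra hne
    exact hX (h.inv_none X.2 X.1 h1 hne)

theorem isWriteOp (h : ExtendsByRead r q T j) {X : Op n} {v : V} (hX : q.IsWriteOp X v) :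
    r.IsWriteOp X v := by
  rcases h.lt_or_eq (X := X) (by rw [IsOp, show q.inv X.2 X.1 = _ from hX]; simp) with h1 | rfl
  · rw [IsWriteOp, ← h.inv _ h1.1]; exact hX
  · have := h.inv_read.symm.trans hX
    simp at this

theorem wellFormed (h : ExtendsByRead r q T j) {v₀ : V} (hr : r.WellFormed v₀)
    (hj : ∀ t < T, r.IsOp (j, t) → ∃ s w, t < s ∧ s < T ∧ r.act s j = Act.ret w) :
    q.WellFormed v₀ where
  sequential i t t' htt' ht ht' := by
    rcases h.lt_or_eq ht with ⟨h1, h2⟩ | h1 <;> rcases h.lt_or_eq ht' with ⟨h1', h2'⟩ | h1'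
    · obtain ⟨s, w, h3, h4, h5⟩ := hr.sequential i t t' htt' h2 h2'
      exact ⟨s, w, h3, h4, by rw [h.act s (h4.trans h1'), h5]⟩
    · cases h1'
      obtain ⟨s, w, h3, h4, h5⟩ := hj t h1 h2
      exact ⟨s, w, h3, by omega, by rw [h.act s h4, h5]⟩
    · cases h1
      dsimp only at h1'
      omega
    · cases h1
      cases h1'
      omega
  unique_write X Y v hX hY := hr.unique_write X Y v (h.isWriteOp hX) (h.isWriteOp hY)
  default_not_written X hX := hr.default_not_written X (h.isWriteOp hX)

theorem returns (h : ExtendsByRead r q T j) {X : Op n} {e : ℕ} {w : RegResp V} (he : e ≤ T)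
    (hX : r.Returns X e w) : q.Returns X e w := by
  obtain ⟨h1, s, rfl, h2, h3, h4⟩ := hX
  refine ⟨by rw [IsOp, h.inv _ (by omega)]; exact h1, s, rfl, h2,
    by rw [h.act s (by omega)]; exact h3, fun u w' hu hu' => ?_⟩
  rw [h.act u (by omega)]
  exact h4 u w' hu hu'

theorem isValOp (h : ExtendsByRead r q T j) {X : Op n} {v : V} {e : ℕ} {w : RegResp V}
    (he : e ≤ T) (hX : r.Returns X e w) (hv : r.IsValOp X v) : q.IsValOp X v := by
  have hlt : X.2 < T := by
    obtain ⟨-, s, rfl, h2, -⟩ := hX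
    omega
  unfold IsValOp
  rw [h.inv _ hlt]
  refine hv.imp id fun ⟨h1, e', h2⟩ => ⟨h1, e', h.returns ?_ h2⟩
  rw [(h2.unique hX).1]
  exact he

end ExtendsByRead

/-- In an obstruction-free implementation, a finite part of a run can be extended by a completed
read, provided that no operation is pending at its process. -/
theorem exists_extendsByRead {r : Run n Var Val Lbl V} {I : RegImpl n Var Val Lbl V} {v₀ : V}
    (hfree : I.ObstructionFree v₀) (hr : r.IsRunOf I) (hwf : r.WellFormed v₀) {T : ℕ} {j : Fin n}
    (hj : ∀ t < T, r.IsOp (j, t) → ∃ s w, t < s ∧ s < T ∧ r.act s j = Act.ret w) :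
    ∃ q : Run n Var Val Lbl V, q.IsRunOf I ∧ q.WellFormed v₀ ∧ q.state T = r.state T ∧
      ExtendsByRead r q T j ∧ q.Completes (j, T + 1) := by
  set p := r.glue T (idleRead (r.state T) j) 0 with hp
  have hpT : p.state T = r.state T := by simp [hp, glue, idleRead]
  have hprun : p.IsRunOf I := glue_isRunOf (by simp [idleRead]) hr.init_mem hr.init_buf
    hr.init_loc (fun t _ => hr.validRound t) fun t _ => idleRead_validRound _ _ _ _
  have hpext : ExtendsByRead r p T j := by
    refine ⟨fun t ht => by simp [hp, glue, ht], fun t ht => by simp [hp, glue, ht],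
      by simp [hp, glue, idleRead], fun t i ht hne => ?_⟩
    simp only [hp, glue, if_neg (not_lt.2 ht), idleRead, ite_eq_right_iff]
    rintro ⟨h1, rfl⟩
    exact (hne (by rw [show t = T + 1 by omega])).elim
  -- Obstruction-freeness is applied just after the invocation, which must belong to the common
  -- prefix.
  obtain ⟨q, h1, h2, h3, h4, -, h6⟩ := hfree p hprun (hpext.wellFormed hwf hj) (j, T + 1) (T + 2)
    (by simp [IsOp, hpext.inv_read]) (by simp)
    (fun e w ⟨_, s, he, hs, _⟩ => by simp only at hs; omega)
  have hqext : ExtendsByRead r q T j := by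
    refine ⟨fun t ht => ?_, fun t ht => ?_, ?_, fun t i ht hne => ?_⟩
    · rw [(h3 t (by omega)).1, hpext.act t ht]
    · rw [(h3 t (by omega)).2.2, hpext.inv t ht]
    · rw [(h3 _ (by omega)).2.2, hpext.inv_read]
    · rcases lt_or_ge t (T + 2) with h | h
      · rw [(h3 t h).2.2, hpext.inv_none t i ht hne]
      · exact h4 t h i
  exact ⟨q, h1, hqext.wellFormed hwf hj, by rw [h2 T (by omega), hpT], hqext, h6⟩

/-! ### The cut that avoids the future of a node -/

/-- The nodes before time `T` that are neither `θ` nor after `θ` in the occurs-before relation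
form a cut. -/
theorem exists_isCut_of_node (r : Run n Var Val Lbl V) (θ : Node n) (T : ℕ) :
    ∃ τ : Agent n → ℕ, r.IsCut τ ∧ (∀ b, τ b ≤ T) ∧ τ θ.1 ≤ θ.2 ∧
      ∀ b, ¬ (θ = (b, T) ∨ r.OB θ (b, T)) → τ b = T := by
  classical
  set F : Node n → Prop := fun η => θ = η ∨ r.OB θ η with hF
  have hup : ∀ η ζ, F η → r.OB η ζ → F ζ := by
    rintro η ζ (rfl | h) h'
    · exact Or.inr h'
    · exact Or.inr (h.trans _ _ _ h')
  have hex : ∀ b, ∃ t, F (b, t) ∨ t = T := fun b => ⟨T, Or.inr rfl⟩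
  have hle : ∀ b, Nat.find (hex b) ≤ T := fun b => Nat.find_min' _ (Or.inr rfl)
  refine ⟨fun b => Nat.find (hex b), ⟨fun b u c u' h hu => ?_, T, hle⟩, hle,
    Nat.find_min' _ (Or.inl (Or.inl rfl)), fun b hb => ?_⟩
  · by_contra hge
    have hlt := h.lt
    have hT := hle c
    have hFb : F (b, u) := by
      rcases Nat.find_spec (hex b) with h1 | h1
      · rcases (not_lt.1 hge).eq_or_lt with h2 | h2
        · rwa [h2] at h1
        · exact hup _ _ h1 (OB.locality b _ _ h2)
      · dsimp only at hlt
        omega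
    exact Nat.find_min (hex c) hu (Or.inl (hup _ _ hFb h))
  · rcases Nat.find_spec (hex b) with h1 | h1
    · rcases (hle b).eq_or_lt with h2 | h2
      · exact h2
      · exact (hb (hup _ _ h1 (OB.locality b _ _ h2))).elim
    · exact h1

end Run
end TSO

/-! ### Proof of the theorem -/

theorem mainTheorem4 {n : ℕ} {Var Val Lbl V : Type*} [DecidableEq Var]
    (v₀ : V) (I : TSO.RegImpl n Var Val Lbl V)
    (hlin : I.Linearizable v₀) (hfree : I.ObstructionFree v₀)
    (r : TSO.Run n Var Val Lbl V) (hr : r.IsRunOf I) (hwf : r.WellFormed v₀)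
    (hrace : r.NoReadPropRace)
    (X Y : TSO.Op n) (a b : V) (hab : a ≠ b)
    (hX : r.IsValOp X a) (hY : r.IsValOp Y b)
    (hXY : r.Precedes X Y) (hcomp : r.Completes Y) (hiso : r.Isolated Y) :
    r.OpOB X Y := by
  open TSO TSO.Run in
  obtain ⟨-, e, wX, hXe, heY⟩ := hXY
  obtain ⟨T, wY, hYT⟩ := hcomp
  refine ⟨T, wY, hYT, ?_⟩
  by_contra hob
  have hYT' := hYT
  obtain ⟨hYop, z, rfl, hz1, hz2, -⟩ := hYT'
  have hXe' := hXe
  obtain ⟨hXop, y, rfl, hy1, -⟩ := hXe'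
  -- all other operations invoked before `Y` ends are completed before `Y` starts
  have hother : ∀ Z : Op n, r.IsOp Z → Z ≠ Y → Z.2 < z + 1 →
      ∃ e w, r.Returns Z e w ∧ e < Y.2 := by
    intro Z hZ hne hlt
    rcases hiso Z hZ hne with h | ⟨-, e', w', h, h'⟩
    · exact h.2
    · have := (h.unique hYT).1
      omega
  obtain ⟨q, hq, hqwf, hqT, hext, hqR⟩ := exists_extendsByRead (T := z + 1) (j := Y.1)
    hfree hr hwf (by
      intro t ht hop
      by_cases hne : ((Y.1, t) : Op n) = Y
      · rw [← hne] at hz1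
        exact ⟨z, wY, hz1, by omega, hz2⟩
      · obtain ⟨_, w, ⟨-, s, rfl, h1, h2, -⟩, h3⟩ := hother _ hop hne ht
        exact ⟨s, w, h1, by omega, h2⟩)
  -- One idle round separates `R` from the end of `Y` at `z + 1`, since real-time precedence is
  -- strict.
  set R : Op n := (Y.1, z + 1 + 1) with hR
  have hRop : q.IsOp R := by simp [IsOp, hR, hext.inv_read]
  have hqY := hext.isValOp le_rfl hYT hY
  have hqX := hext.isValOp (by omega) hXe hX
  have hqYe := hext.returns le_rfl hYT
  have hqXe := hext.returns (by omega) hXe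
  have hqRb : q.IsValOp R b := by
    refine (hlin q hq hqwf).isValOp_of_follows hqY hext.inv_read
      ⟨hRop, _, _, hqYe, by simp [hR]⟩ hqR fun Z hZ hZY hZR => ?_
    obtain ⟨h1, h2⟩ := (hext.lt_or_eq hZ).resolve_right hZR
    obtain ⟨e, w, h3, h4⟩ := hother Z h2 hZY h1
    exact ⟨hqYe.1, e, w, hext.returns (by omega) h3, h4⟩
  obtain ⟨τ, hτ, hτT, hτX, hτY⟩ := r.exists_isCut_of_node (Agent.proc X.1, X.2) (z + 1)
  -- The only use of the assumption that `X.s` does not occur before `Y.e`: the process of `Y` is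
  -- not delayed until `Y` has ended.
  have hYτ : τ (Agent.proc Y.1) = z + 1 := by
    refine hτY _ (not_or.2 ⟨fun h => ?_, hob⟩)
    have := congrArg Prod.snd h
    dsimp only at this
    omega
  -- The delay exceeds `z + 1`, so `X` starts strictly after the end of `Y` even if `X.2 = 0`.
  obtain ⟨r', hr', hins⟩ := exists_delayed (Δ := z + 2) hr hrace hq hqT
    (fun t ht => ⟨hext.act t ht, hext.inv t ht⟩) hτ hτT (by omega) (by omega)
  have hwf' := hins.wellFormed hqwf
  obtain ⟨eR, wR, hRe⟩ := hqR
  obtain ⟨x, rfl⟩ : ∃ x, eR = x + 1 := ⟨_, hRe.2.choose_spec.1⟩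
  refine hab ((hlin r' hr' hwf').eq_of_precedes hwf' (hins.isValOp hqY) (hins.isValOp hqX)
    (hins.isValOp hqRb) ⟨?_, _, _, hins.returns hqYe, ?_⟩ ⟨?_, _, _, hins.returns hqXe, ?_⟩
    ⟨_, _, hins.returns hRe⟩)
  · rw [IsOp, hins.inv_shiftOp]; exact hqXe.1
  · dsimp only at hτX
    simp only [InsertsIdle.shift, InsertsIdle.shiftOp, hYτ]
    split_ifs <;> omega
  · rw [IsOp, hins.inv_shiftOp]; exact hRop
  · simp only [InsertsIdle.shift, InsertsIdle.shiftOp, hR, hYτ]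
    split_ifs <;> omega
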